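/- Let $N=n^2$ with $n\ge 2$. Index rows, columns, symbols and the $N$ blocks of size $n\times n$ by $1,\dots,N$ (blocks numbered row by row, so block $N$ contains position $(N,N)$); let $a(i,j)$ be the block containing position $(i,j)$. A filled grid $S$ (number $S(i,j)$ in position $(i,j)$) is a valid (blank) Sudoku solution if every row, every column and every block contains each number precisely once. An instance $P$ of generalised Sudoku fixes numbers in some (possibly no) positions; it is solvable if some valid Sudoku solution has all the fixed numbers. **The graph $G_N$.** Vertices, for $a,i,j,k\in\{1,\dots,N\}$ and $l\in\{1,2,3\}$: start $s$, finish $f$, block vertices $b_{ak}$, row vertices $r_{ik}$, end row vertices $t_i$, column vertices $c_{jk}$, end column vertices $d_j$, puzzle vertices $x_{ijkl}$, end puzzle vertices $v_{ij}$, duplicate puzzle vertices $y_{ijkl}$ and end duplicate puzzle vertices $w_{ij}$. Directed edges, for all $i,j,k$ unless restricted, where $a=a(i,j)$ and symbol indices $k\pm1,k+2$ are wrapped cyclically into $\{1,\dots,N\}$: - $(s,b_{11})$, $(d_N,f)$, $(f,s)$; $(b_{ak},x_{i,j,k+1,1})$; - $(x_{ijk1},x_{ijk2})$, $(x_{ijk2},x_{ijk1})$,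 $(x_{ijk2},x_{ijk3})$, $(x_{ijk3},x_{ijk2})$, $(x_{ijk3},x_{i,j,k+1,1})$, and the same five edges with $y$ in place of $x$; $(x_{ijk3},y_{i,j,k+2,1})$; - $(y_{ijk3},b_{a,k+2})$ for $k\ne N-1$; $(y_{i,j,N-1,3},b_{a+1,1})$ if $a<N$; $(y_{i,j,N-1,3},r_{11})$ if $a=N$; - $(r_{ik},x_{ijk3})$, $(x_{ijk1},v_{ij})$, $(v_{ij},r_{ik})$, $(v_{ij},t_i)$, $(t_i,r_{i+1,1})$ for $i<N$, $(t_N,c_{11})$; - $(c_{jk},y_{ijk3})$, $(y_{ijk1},w_{ij})$, $(w_{ij},c_{jk})$, $(w_{ij},d_j)$, $(d_j,c_{j+1,1})$ for $j<N$. For a block $a$ and a number $k$ let $e(a,k)$ be $b_{a,k+1}$ if $k<N$, $b_{a+1,1}$ if $k=N$ and $a<N$, and $r_{11}$ if $k=a=N$. **Correspondence.** A Hamiltonian cycle $h$ of $G_N$ and a filled grid $S$ correspond to each other if for every position $(i,j)$, with $a=a(i,j)$ and $k=S(i,j)$, the following are sequences of consecutive vertices of $h$ (an $x_{ijm}$ or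 $y_{ijm}$ standing for the three vertices with $l=1,2,3$ in this order): $b_{ak},x_{i,j,k+1},x_{i,j,k+2},\dots,x_{i,j,k-1},y_{i,j,k+1},\dots,y_{i,j,k-1},e(a,k)$ (all $m\neq k$ in cyclic order); $r_{ik},x_{ijk3},x_{ijk2},x_{ijk1},v_{ij}$; and $c_{jk},y_{ijk3},y_{ijk2},y_{ijk1},w_{ij}$. **The graph $G_P$ of an instance.** It is obtained from $G_N$ by removing, for each number $k$ fixed in a position $(i,j)$ with block $a=a(i,j)$, the following edges: - for all positions $(m,q)\neq(i,j)$ of block $a$: $(b_{ak},x_{m,q,k+1,1})$, $(x_{m,q,k-1,3},y_{m,q,k+1,1})$, $(y_{m,q,k-1,3},e(a,k))$; - for all $m\ne k$: $(b_{am},x_{i,j,m+1,1})$, $(x_{i,j,m-1,3},y_{i,j,m+1,1})$, $(y_{i,j,m-1,3},e(a,m))$, $(r_{im},x_{ijm3})$, $(c_{jm},y_{ijm3})$; - for all $m\neq j$: $(r_{ik},x_{imk3})$, $(x_{imk1},v_{im})$; for all $m\ne i$: $(c_{jk},y_{mjk3})$, $(y_{mjk1},w_{mj})$. **Theorem.**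 For all $n\geq2$ and $N=n^2$: 1. $G_N$ has $6N^3+5N^2+2N+2$ vertices. 2. Every Hamiltonian cycle of $G_N$ corresponds to exactly one filled grid, and this grid is a valid Sudoku solution. 3. Every valid Sudoku solution corresponds to at least one Hamiltonian cycle of $G_N$. 4. An instance $P$ of generalised Sudoku with $N$ symbols is solvable if and only if $G_P$ has a Hamiltonian cycle. Moreover, $P\mapsto G_P$ is computable in polynomial time as a function of $N$, so that it is a polynomial-time reduction of generalised Sudoku to the directed Hamiltonian cycle problem: there are one program for a random access machine (unit cost; addition, truncated subtraction, indirect addressing, tests for zero, no multiplication) and one polynomial $p$ such that for all $n\ge2$ and all instances $P$ with $N=n^2$ symbols, the program, given $N$ and the $N^2$ entries of $P$ row by row ($0$ for an empty position), halts after at most $p(N)$ steps and has output the number of vertices of $G_P$ and a list of all its edges, each once, as pairs of vertex labels (the vertices being labelled $1,2,3,\dots$ in the order $s$, $f$, $b$, $r$, $t$, $c$, $d$, $x$, $v$, $y$, $w$, and lexicographically within each kind). -/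

import Mathlib

namespace SudokuHCP

/-! ### Sudoku

The block side is `n` and the number of symbols is `N = n ^ 2`.  Rows, columns, blocks and symbols,
which are numbered `1, …, N` on paper, are elements `0, …, N - 1` of `Fin (n ^ 2)`. -/

/-- Indices and symbols of Sudoku with `N = n ^ 2` symbols. -/
abbrev Idx (n : ℕ) : Type := Fin (n ^ 2)

/-- The number `k + c`, wrapped around cyclically into the range of the `N` symbols.
In particular `shift k (n ^ 2 - 1)` is the wrapped `k - 1`. -/
def shift {n : ℕ} (k : Idx n) (c : ℕ) : Idx n :=
  ⟨(k.val + c) % n ^ 2, Nat.mod_lt _ k.pos⟩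

theorem block_lt {n : ℕ} (i j : Idx n) : n * (i.val / n) + j.val / n < n ^ 2 := by
  have hi : i.val / n < n := Nat.div_lt_of_lt_mul (i.isLt.trans_eq (sq n))
  have hj : j.val / n < n := Nat.div_lt_of_lt_mul (j.isLt.trans_eq (sq n))
  nlinarith

/-- The block containing position `(i, j)`; the `N` blocks of size `n × n` are numbered row by row. -/
def block {n : ℕ} (i j : Idx n) : Idx n := ⟨n * (i.val / n) + j.val / n, block_lt i j⟩

/-- A filled grid: `S i j` is the number placed in position `(i, j)`. -/
abbrev Grid (n : ℕ) : Type := Idx n → Idx n → Idx n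

/-- A valid (blank) Sudoku solution: each row, each column and each block contains each number
precisely once. -/
structure IsSudoku {n : ℕ} (S : Grid n) : Prop where
  row : ∀ i k : Idx n, ∃! j : Idx n, S i j = k
  col : ∀ j k : Idx n, ∃! i : Idx n, S i j = k
  blk : ∀ a k : Idx n, ∃! p : Idx n × Idx n, block p.1 p.2 = a ∧ S p.1 p.2 = k

/-- A Sudoku instance: `P i j = some k` if the number `k` is fixed in position `(i, j)`, and
`P i j = none` if that position is empty. -/
abbrev Puzzle (n : ℕ) : Type := Idx n → Idx n → Option (Idx n)

/-- `S` is a solution of the instance `P`. -/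
def Solves {n : ℕ} (S : Grid n) (P : Puzzle n) : Prop :=
  IsSudoku S ∧ ∀ i j k : Idx n, P i j = some k → S i j = k

/-- The decision problem generalised Sudoku. -/
def Solvable {n : ℕ} (P : Puzzle n) : Prop := ∃ S : Grid n, Solves S P

/-! ### Hamiltonian cycles of directed graphs -/

/-- A Hamiltonian cycle of a directed graph, given by the map that sends each vertex to the one
visited immediately after it: a permutation with a single orbit that moves along edges. -/
def IsHamCycle {V : Type*} (G : Digraph V) (σ : Equiv.Perm V) : Prop :=
  σ.IsCycleOn Set.univ ∧ ∀ u : V, G.Adj u (σ u)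

/-- The decision problem directed Hamiltonian cycle. -/
def IsHamiltonian {V : Type*} (G : Digraph V) : Prop := ∃ σ : Equiv.Perm V, IsHamCycle G σ

/-! ### The graph of the blank puzzle -/

/-- The vertices.  The last index of `x` and `y`, which is `1, 2, 3` on paper, is `0, 1, 2` here. -/
inductive Vert (n : ℕ) : Type where
  | s : Vert n
  | f : Vert n
  | b (a k : Idx n) : Vert n
  | r (i k : Idx n) : Vert n
  | t (i : Idx n) : Vert n
  | c (j k : Idx n) : Vert n
  | d (j : Idx n) : Vert n
  | x (i j k : Idx n) (l : Fin 3) : Vert n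
  | v (i j : Idx n) : Vert n
  | y (i j k : Idx n) (l : Fin 3) : Vert n
  | w (i j : Idx n) : Vert n

open Vert

/-- The directed edges.  A hypothesis `k.val = 0` says that `k` is the first index (`1` on paper),
`k.val + 1 = n ^ 2` that it is the last one (`N`), and `k.val + 2 = n ^ 2` that it is `N - 1`. -/
inductive Edge {n : ℕ} : Vert n → Vert n → Prop where
  | s_b (a k : Idx n) (ha : a.val = 0) (hk : k.val = 0) : Edge s (b a k)
  | d_f (j : Idx n) (hj : j.val + 1 = n ^ 2) : Edge (d j) f
  | f_s : Edge f s
  | b_x (i j k : Idx n) : Edge (b (block i j) k) (x i j (shift k 1) 0)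
  | x_01 (i j k : Idx n) : Edge (x i j k 0) (x i j k 1)
  | x_10 (i j k : Idx n) : Edge (x i j k 1) (x i j k 0)
  | x_12 (i j k : Idx n) : Edge (x i j k 1) (x i j k 2)
  | x_21 (i j k : Idx n) : Edge (x i j k 2) (x i j k 1)
  | x_x (i j k : Idx n) : Edge (x i j k 2) (x i j (shift k 1) 0)
  | y_01 (i j k : Idx n) : Edge (y i j k 0) (y i j k 1)
  | y_10 (i j k : Idx n) : Edge (y i j k 1) (y i j k 0)
  | y_12 (i j k : Idx n) : Edge (y i j k 1) (y i j k 2)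
  | y_21 (i j k : Idx n) : Edge (y i j k 2) (y i j k 1)
  | y_y (i j k : Idx n) : Edge (y i j k 2) (y i j (shift k 1) 0)
  | x_y (i j k : Idx n) : Edge (x i j k 2) (y i j (shift k 2) 0)
  | y_b (i j k : Idx n) (hk : k.val + 2 ≠ n ^ 2) :
      Edge (y i j k 2) (b (block i j) (shift k 2))
  | y_b_next (i j k a' k' : Idx n) (hk : k.val + 2 = n ^ 2)
      (ha' : a'.val = (block i j).val + 1) (hk' : k'.val = 0) : Edge (y i j k 2) (b a' k')
  | y_r (i j k i' k' : Idx n) (hk : k.val + 2 = n ^ 2) (ha : (block i j).val + 1 = n ^ 2)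
      (hi' : i'.val = 0) (hk' : k'.val = 0) : Edge (y i j k 2) (r i' k')
  | r_x (i j k : Idx n) : Edge (r i k) (x i j k 2)
  | x_v (i j k : Idx n) : Edge (x i j k 0) (v i j)
  | v_r (i j k : Idx n) : Edge (v i j) (r i k)
  | v_t (i j : Idx n) : Edge (v i j) (t i)
  | t_r (i i' k' : Idx n) (hi' : i'.val = i.val + 1) (hk' : k'.val = 0) : Edge (t i) (r i' k')
  | t_c (i j' k' : Idx n) (hi : i.val + 1 = n ^ 2) (hj' : j'.val = 0) (hk' : k'.val = 0) :
      Edge (t i) (c j' k')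
  | c_y (i j k : Idx n) : Edge (c j k) (y i j k 2)
  | y_w (i j k : Idx n) : Edge (y i j k 0) (w i j)
  | w_c (i j k : Idx n) : Edge (w i j) (c j k)
  | w_d (i j : Idx n) : Edge (w i j) (d j)
  | d_c (j j' k' : Idx n) (hj' : j'.val = j.val + 1) (hk' : k'.val = 0) : Edge (d j) (c j' k')

/-- The directed graph constructed for the blank puzzle. -/
def blankGraph (n : ℕ) : Digraph (Vert n) := ⟨Edge⟩

/-- `BlockExit a k u`: the vertex `u` is the one visited once number `k` has been placed in
block `a`, i.e. the next block vertex, or `r₁₁` after the last block vertex. -/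
inductive BlockExit {n : ℕ} : Idx n → Idx n → Vert n → Prop where
  | next_number (a k k' : Idx n) (hk' : k'.val = k.val + 1) : BlockExit a k (b a k')
  | next_block (a k a' k' : Idx n) (hk : k.val + 1 = n ^ 2) (ha' : a'.val = a.val + 1)
      (hk' : k'.val = 0) : BlockExit a k (b a' k')
  | last (a k i' k' : Idx n) (hk : k.val + 1 = n ^ 2) (ha : a.val + 1 = n ^ 2)
      (hi' : i'.val = 0) (hk' : k'.val = 0) : BlockExit a k (r i' k')

/-- The way in which a Hamiltonian cycle (with successor map `σ`) and a filled grid `S` correspond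
to each other.  For each position `(i, j)`, in block `a` and holding number `k = S i j`:
* `b a k` is followed by all `x i j m l` with `m ≠ k` (cyclically from `m = k + 1` to `m = k - 1`),
  then by all `y i j m l` with `m ≠ k`, then by the vertex of `BlockExit`;
* `r i k` is followed by the three `x i j k l` in descending order of `l` and then `v i j`;
* `c j k` is followed by the three `y i j k l` in descending order of `l` and then `w i j`. -/
structure Corresponds {n : ℕ} (σ : Equiv.Perm (Vert n)) (S : Grid n) : Prop where
  b_x : ∀ i j, σ (b (block i j) (S i j)) = x i j (shift (S i j) 1) 0
  x_up : ∀ i j m, m ≠ S i j → σ (x i j m 0) = x i j m 1 ∧ σ (x i j m 1) = x i j m 2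
  x_x : ∀ i j m, m ≠ S i j → shift m 1 ≠ S i j → σ (x i j m 2) = x i j (shift m 1) 0
  x_y : ∀ i j, σ (x i j (shift (S i j) (n ^ 2 - 1)) 2) = y i j (shift (S i j) 1) 0
  y_up : ∀ i j m, m ≠ S i j → σ (y i j m 0) = y i j m 1 ∧ σ (y i j m 1) = y i j m 2
  y_y : ∀ i j m, m ≠ S i j → shift m 1 ≠ S i j → σ (y i j m 2) = y i j (shift m 1) 0
  y_exit : ∀ i j, BlockExit (block i j) (S i j) (σ (y i j (shift (S i j) (n ^ 2 - 1)) 2))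
  row : ∀ i j, σ (r i (S i j)) = x i j (S i j) 2 ∧ σ (x i j (S i j) 2) = x i j (S i j) 1 ∧
    σ (x i j (S i j) 1) = x i j (S i j) 0 ∧ σ (x i j (S i j) 0) = v i j
  col : ∀ i j, σ (c j (S i j)) = y i j (S i j) 2 ∧ σ (y i j (S i j) 2) = y i j (S i j) 1 ∧
    σ (y i j (S i j) 1) = y i j (S i j) 0 ∧ σ (y i j (S i j) 0) = w i j

/-! ### The graph of an instance with fixed numbers -/

/-- The edges that become redundant by the fixed numbers of `P`.  In each case `k` is the number
fixed in position `(i, j)`. -/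
inductive Redundant {n : ℕ} (P : Puzzle n) : Vert n → Vert n → Prop where
  /-- number `k` is placed elsewhere in the block -/
  | blk_b (i j k i' j' : Idx n) (hP : P i j = some k) (hb : block i' j' = block i j)
      (hne : (i', j') ≠ (i, j)) : Redundant P (b (block i j) k) (x i' j' (shift k 1) 0)
  | blk_x (i j k i' j' : Idx n) (hP : P i j = some k) (hb : block i' j' = block i j)
      (hne : (i', j') ≠ (i, j)) :
      Redundant P (x i' j' (shift k (n ^ 2 - 1)) 2) (y i' j' (shift k 1) 0)
  | blk_y (i j k i' j' : Idx n) (u : Vert n) (hP : P i j = some k)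
      (hb : block i' j' = block i j) (hne : (i', j') ≠ (i, j)) (hu : BlockExit (block i j) k u) :
      Redundant P (y i' j' (shift k (n ^ 2 - 1)) 2) u
  /-- a number other than `k` is placed in position `(i, j)` -/
  | cell_b (i j k m : Idx n) (hP : P i j = some k) (hm : m ≠ k) :
      Redundant P (b (block i j) m) (x i j (shift m 1) 0)
  | cell_x (i j k m : Idx n) (hP : P i j = some k) (hm : m ≠ k) :
      Redundant P (x i j (shift m (n ^ 2 - 1)) 2) (y i j (shift m 1) 0)
  | cell_y (i j k m : Idx n) (u : Vert n) (hP : P i j = some k) (hm : m ≠ k)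
      (hu : BlockExit (block i j) m u) : Redundant P (y i j (shift m (n ^ 2 - 1)) 2) u
  | cell_r (i j k m : Idx n) (hP : P i j = some k) (hm : m ≠ k) :
      Redundant P (r i m) (x i j m 2)
  | cell_c (i j k m : Idx n) (hP : P i j = some k) (hm : m ≠ k) :
      Redundant P (c j m) (y i j m 2)
  /-- number `k` is found elsewhere in row `i` -/
  | row_r (i j k j' : Idx n) (hP : P i j = some k) (hj : j' ≠ j) :
      Redundant P (r i k) (x i j' k 2)
  | row_v (i j k j' : Idx n) (hP : P i j = some k) (hj : j' ≠ j) :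
      Redundant P (x i j' k 0) (v i j')
  /-- number `k` is found elsewhere in column `j` -/
  | col_c (i j k i' : Idx n) (hP : P i j = some k) (hi : i' ≠ i) :
      Redundant P (c j k) (y i' j k 2)
  | col_w (i j k i' : Idx n) (hP : P i j = some k) (hi : i' ≠ i) :
      Redundant P (y i' j k 0) (w i' j)

/-- The directed graph of the instance `P`: the graph of the blank puzzle without the edges that
the fixed numbers of `P` make redundant. -/
def puzzleGraph {n : ℕ} (P : Puzzle n) : Digraph (Vert n) :=
  ⟨fun u u' => Edge u u' ∧ ¬ Redundant P u u'⟩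

/-! ### Random access machines with a step count -/

/-- Basic instructions of a random access machine whose memory cells `0, 1, 2, …` hold natural
numbers.  Each takes one step; there is no multiplication, so in polynomially many steps numbers
keep polynomial bit length, and unit cost is polynomially related to Turing machine time. -/
inductive Instr : Type where
  /-- `M[p] := z` -/
  | const (p z : ℕ) : Instr
  /-- `M[p] := M[q] + M[q']` -/
  | add (p q q' : ℕ) : Instr
  /-- `M[p] := M[q] - M[q']`, truncated at `0` -/
  | sub (p q q' : ℕ) : Instr
  /-- `M[p] := M[M[q]]` -/
  | load (p q : ℕ) : Instr
  /-- `M[M[p]] := M[q]` -/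
  | store (p q : ℕ) : Instr
  /-- `M[p] :=` the length of the input -/
  | len (p : ℕ) : Instr
  /-- `M[p] :=` the input entry at place `M[q]` (counted from `0`), or `0` beyond the input -/
  | read (p q : ℕ) : Instr
  /-- append `M[p]` to the output -/
  | write (p : ℕ) : Instr

/-- Memory and output written so far. -/
structure RamState : Type where
  mem : ℕ → ℕ
  out : List ℕ

/-- All memory cells are `0` and the output is empty. -/
def RamState.init : RamState := ⟨fun _ => 0, []⟩

/-- The effect of a basic instruction on input `inp`. -/
def Instr.exec (inp : List ℕ) : Instr → RamState → RamState
  | .const p z, S => ⟨Function.update S.mem p z, S.out⟩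
  | .add p q q', S => ⟨Function.update S.mem p (S.mem q + S.mem q'), S.out⟩
  | .sub p q q', S => ⟨Function.update S.mem p (S.mem q - S.mem q'), S.out⟩
  | .load p q, S => ⟨Function.update S.mem p (S.mem (S.mem q)), S.out⟩
  | .store p q, S => ⟨Function.update S.mem (S.mem p) (S.mem q), S.out⟩
  | .len p, S => ⟨Function.update S.mem p inp.length, S.out⟩
  | .read p q, S => ⟨Function.update S.mem p (inp.getD (S.mem q) 0), S.out⟩
  | .write p, S => ⟨S.mem, S.out ++ [S.mem p]⟩

/-- Programs. -/
inductive Prog : Type where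
  | instr (o : Instr) : Prog
  | seq (A B : Prog) : Prog
  /-- if `M[p] ≠ 0` then `A` else `B` -/
  | ite (p : ℕ) (A B : Prog) : Prog
  /-- while `M[p] ≠ 0` do `A` -/
  | loop (p : ℕ) (A : Prog) : Prog

/-- `Runs inp A S T S'`: on input `inp`, the program `A`, started in state `S`, halts in state `S'`
after exactly `T` steps.  Instructions and tests take one step each. -/
inductive Runs (inp : List ℕ) : Prog → RamState → ℕ → RamState → Prop where
  | instr (o : Instr) (S : RamState) : Runs inp (.instr o) S 1 (o.exec inp S)
  | seq {A B : Prog} {S S' S'' : RamState} {T T' : ℕ} (hA : Runs inp A S T S')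
      (hB : Runs inp B S' T' S'') : Runs inp (.seq A B) S (T + T') S''
  | ite_true {p : ℕ} {A B : Prog} {S S' : RamState} {T : ℕ} (hp : S.mem p ≠ 0)
      (hA : Runs inp A S T S') : Runs inp (.ite p A B) S (T + 1) S'
  | ite_false {p : ℕ} {A B : Prog} {S S' : RamState} {T : ℕ} (hp : S.mem p = 0)
      (hB : Runs inp B S T S') : Runs inp (.ite p A B) S (T + 1) S'
  | loop_done {p : ℕ} {A : Prog} {S : RamState} (hp : S.mem p = 0) :
      Runs inp (.loop p A) S 1 S
  | loop_step {p : ℕ} {A : Prog} {S S' S'' : RamState} {T T' : ℕ} (hp : S.mem p ≠ 0)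
      (hA : Runs inp A S T S') (hL : Runs inp (.loop p A) S' T' S'') :
      Runs inp (.loop p A) S (T + 1 + T') S''

/-! ### Encoding of instances -/

/-- The input for the instance `P`: the number `N = n ^ 2` and then the entries of the `N²`
positions, row by row, with `0` for an empty position and `1, …, N` for a fixed number. -/
def encodePuzzle {n : ℕ} (P : Puzzle n) : List ℕ :=
  n ^ 2 :: (List.finRange (n ^ 2)).flatMap fun i =>
    (List.finRange (n ^ 2)).map fun j => ((P i j).map fun k => k.val + 1).getD 0

/-- The label of a vertex: the vertices are numbered `1, 2, 3, …` in the order `s`, `f`, `b`, `r`,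
`t`, `c`, `d`, `x`, `v`, `y`, `w`, and lexicographically by their indices within each kind. -/
def label {n : ℕ} : Vert n → ℕ
  | .s => 1
  | .f => 2
  | .b a k => 3 + a * n ^ 2 + k
  | .r i k => 3 + (n ^ 2) ^ 2 + i * n ^ 2 + k
  | .t i => 3 + 2 * (n ^ 2) ^ 2 + i
  | .c j k => 3 + 2 * (n ^ 2) ^ 2 + n ^ 2 + j * n ^ 2 + k
  | .d j => 3 + 3 * (n ^ 2) ^ 2 + n ^ 2 + j
  | .x i j k l => 3 + 3 * (n ^ 2) ^ 2 + 2 * n ^ 2 + 3 * ((i * n ^ 2 + j) * n ^ 2 + k) + l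
  | .v i j => 3 + 3 * (n ^ 2) ^ 3 + 3 * (n ^ 2) ^ 2 + 2 * n ^ 2 + i * n ^ 2 + j
  | .y i j k l => 3 + 3 * (n ^ 2) ^ 3 + 4 * (n ^ 2) ^ 2 + 2 * n ^ 2 +
      3 * ((i * n ^ 2 + j) * n ^ 2 + k) + l
  | .w i j => 3 + 6 * (n ^ 2) ^ 3 + 4 * (n ^ 2) ^ 2 + 2 * n ^ 2 + i * n ^ 2 + j

/-- `out` describes the directed graph `G`: it is the number of vertices, followed by the labels
of tail and head of each edge, the edges being listed once each, in any order. -/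
def DescribesGraph {n : ℕ} (out : List ℕ) (G : Digraph (Vert n)) : Prop :=
  ∃ L : List (Vert n × Vert n), L.Nodup ∧ (∀ u u' : Vert n, (u, u') ∈ L ↔ G.Adj u u') ∧
    out = Nat.card (Vert n) :: L.flatMap fun e => [label e.1, label e.2]

end SudokuHCP

open SudokuHCP

namespace SudokuHCP
open Vert

/-! ### Cyclic shifts -/

/-! From cycles to grids. The middle vertex of a triple `x i j k 0, 1, 2` has no neighbours but the
two ends, so a Hamiltonian cycle runs through the triple either upwards or downwards
(`triple_cases`). A descending triple must leave to `v i j`, and `v i j` is entered once, so each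
position has exactly one descending x-triple; its number is `S i j`. Since `r i k` can only enter a
triple from above, every number occurs in every row (`exists_x_grid`). The y-triples give in the
same way a grid `T` with the column property (`exists_y_grid`). Elimination of predecessors then
shows that `b a k` goes to the position of block `a` holding `k`, whence the block property, and
that the y-chain of a position can only be entered if `T` and `S` agree there
(`exists_corresponds`). Beyond the edges, only the absence of 2-cycles is used
(`IsHamCycle.two_cycle_free`).

From grids to cycles. A valid `S` determines a successor map `next`. Starting at `s`, it goes
through the blocks and collects all triples with `k ≠ S i j`, then through the rows with the
x-triples of `S`, then through the columns with the y-triples of `S`, and ends in `f`. Validity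
ensures that no chain breaks off. As everything is reached and `f` leads back to `s`, finiteness
makes `next` a cyclic permutation (`reach_all`, `exists_hamCycle`).

Instances. Every removed edge stands for a placement that contradicts a fixed number, so the cycle
of a solution avoids all of them (`not_redundant_next`). Conversely, a cycle whose grid violates a
fixed number would use a removed edge out of a block vertex.

Complexity. A small language of bounded loops and arithmetic is compiled to the machine; induction
on its syntax gives correctness and a polynomial step bound (`NExpr.compile_spec`,
`Stmt.compile_spec`). The graph is written as nested loops over the vertices, with flags testing
whether an edge is removed. -/

theorem shift_shift {n : ℕ} (k : Idx n) (a b : ℕ) : shift (shift k a) b = shift k (a + b) := by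
  apply Fin.ext
  simp [shift, add_assoc]

theorem shift_size {n : ℕ} (k : Idx n) : shift k (n ^ 2) = k := by
  apply Fin.ext
  simp [shift, Nat.mod_eq_of_lt k.isLt]

theorem shift_zero {n : ℕ} (k : Idx n) : shift k 0 = k := by
  apply Fin.ext
  simp [shift, Nat.mod_eq_of_lt k.isLt]

/-- The shift by `n ^ 2 - 1` is the cyclic shift by -1. The case `c = 0` returns to `k`; the case `c
= 1` is the jump over `k` made by the edges from x to y. -/
theorem shift_pred_succ {n : ℕ} (k : Idx n) (c : ℕ) :
    shift (shift k (n ^ 2 - 1)) (c + 1) = shift k c := by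
  have h := k.pos
  rw [shift_shift, show n ^ 2 - 1 + (c + 1) = n ^ 2 + c by omega, ← shift_shift, shift_size]

theorem shift_succ_pred {n : ℕ} (k : Idx n) : shift (shift k 1) (n ^ 2 - 1) = k := by
  have h := k.pos
  rw [shift_shift, show 1 + (n ^ 2 - 1) = n ^ 2 by omega, shift_size]

theorem shift_injective {n : ℕ} (c : ℕ) : Function.Injective fun k : Idx n => shift k c := by
  intro k m h
  have h' : (k.val + c) % n ^ 2 = (m.val + c) % n ^ 2 := congrArg Fin.val h
  apply Fin.ext
  have := Nat.ModEq.add_right_cancel' c h'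
  rwa [Nat.ModEq, Nat.mod_eq_of_lt k.isLt, Nat.mod_eq_of_lt m.isLt] at this

@[simp] theorem shift_inj {n : ℕ} {c : ℕ} {k m : Idx n} : shift k c = shift m c ↔ k = m :=
  (shift_injective c).eq_iff

theorem shift_ne {n : ℕ} (k : Idx n) {c : ℕ} (h0 : 0 < c) (hc : c < n ^ 2) : shift k c ≠ k := by
  intro h
  have h' : (k.val + c) % n ^ 2 = k.val := congrArg Fin.val h
  have hk := k.isLt
  rcases lt_or_ge (k.val + c) (n ^ 2) with h1 | h1
  · rw [Nat.mod_eq_of_lt h1] at h'; omega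
  · rw [Nat.mod_eq_sub_mod h1, Nat.mod_eq_of_lt (by omega)] at h'; omega

/-- Makes induction along the cyclic order possible: starting behind `k`, all other indices are met
at offsets `1, …, n ^ 2 - 1`. -/
theorem exists_shift_of_ne {n : ℕ} {k m : Idx n} (h : m ≠ k) :
    ∃ c, c + 1 < n ^ 2 ∧ m = shift k (c + 1) := by
  have hk := k.isLt
  have hm := m.isLt
  have h' : m.val ≠ k.val := fun e => h (Fin.ext e)
  rcases lt_or_ge m.val k.val with h1 | h1
  -- Here `m` comes before `k`, so the offset wraps around once.
  · refine ⟨m.val + n ^ 2 - k.val - 1, by omega, Fin.ext ?_⟩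
    simp only [shift]
    rw [show k.val + (m.val + n ^ 2 - k.val - 1 + 1) = m.val + n ^ 2 by omega]
    simp [Nat.mod_eq_of_lt hm]
  · refine ⟨m.val - k.val - 1, by omega, Fin.ext ?_⟩
    simp only [shift]
    rw [show k.val + (m.val - k.val - 1 + 1) = m.val by omega, Nat.mod_eq_of_lt hm]

theorem four_le_sq {n : ℕ} (hn : 2 ≤ n) : 4 ≤ n ^ 2 := by nlinarith

/-! ### Edges out of and into a vertex -/

theorem edge_b_iff {n : ℕ} {a k : Idx n} {u : Vert n} :
    Edge (b a k) u ↔ ∃ i j, block i j = a ∧ u = x i j (shift k 1) 0 := by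
  constructor
  · intro h
    cases h
    exact ⟨_, _, rfl, rfl⟩
  · rintro ⟨i, j, rfl, rfl⟩
    exact Edge.b_x i j k

theorem edge_r_iff {n : ℕ} {i k : Idx n} {u : Vert n} :
    Edge (r i k) u ↔ ∃ j, u = x i j k 2 := by
  constructor
  · intro h
    cases h
    exact ⟨_, rfl⟩
  · rintro ⟨j, rfl⟩
    exact Edge.r_x i j k

theorem edge_c_iff {n : ℕ} {j k : Idx n} {u : Vert n} :
    Edge (c j k) u ↔ ∃ i, u = y i j k 2 := by
  constructor
  · intro h
    cases h
    exact ⟨_, rfl⟩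
  · rintro ⟨i, rfl⟩
    exact Edge.c_y i j k

theorem edge_x0_iff {n : ℕ} {i j k : Idx n} {u : Vert n} :
    Edge (x i j k 0) u ↔ u = x i j k 1 ∨ u = v i j := by
  constructor
  · generalize hw : x i j k 0 = w
    intro h
    cases h <;> simp_all
  · rintro (rfl | rfl)
    exacts [Edge.x_01 i j k, Edge.x_v i j k]

theorem edge_x1_iff {n : ℕ} {i j k : Idx n} {u : Vert n} :
    Edge (x i j k 1) u ↔ u = x i j k 0 ∨ u = x i j k 2 := by
  constructor
  · generalize hw : x i j k 1 = w
    intro h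
    cases h <;> simp_all
  · rintro (rfl | rfl)
    exacts [Edge.x_10 i j k, Edge.x_12 i j k]

theorem edge_x2_iff {n : ℕ} {i j k : Idx n} {u : Vert n} :
    Edge (x i j k 2) u ↔
      u = x i j k 1 ∨ u = x i j (shift k 1) 0 ∨ u = y i j (shift k 2) 0 := by
  constructor
  · generalize hw : x i j k 2 = w
    intro h
    cases h <;> simp_all
  · rintro (rfl | rfl | rfl)
    exacts [Edge.x_21 i j k, Edge.x_x i j k, Edge.x_y i j k]

theorem edge_y0_iff {n : ℕ} {i j k : Idx n} {u : Vert n} :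
    Edge (y i j k 0) u ↔ u = y i j k 1 ∨ u = w i j := by
  constructor
  · generalize hw : y i j k 0 = w
    intro h
    cases h <;> simp_all
  · rintro (rfl | rfl)
    exacts [Edge.y_01 i j k, Edge.y_w i j k]

theorem edge_y1_iff {n : ℕ} {i j k : Idx n} {u : Vert n} :
    Edge (y i j k 1) u ↔ u = y i j k 0 ∨ u = y i j k 2 := by
  constructor
  · generalize hw : y i j k 1 = w
    intro h
    cases h <;> simp_all
  · rintro (rfl | rfl)
    exacts [Edge.y_10 i j k, Edge.y_12 i j k]

theorem shift_one_val_last {n : ℕ} {k : Idx n} (hk : k.val + 2 = n ^ 2) :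
    (shift k 1).val + 1 = n ^ 2 := by
  simp only [shift]
  rw [Nat.mod_eq_of_lt (by omega)]
  omega

theorem shift_one_val_last_iff {n : ℕ} (hn : 2 ≤ n) {k : Idx n} :
    (shift k 1).val + 1 = n ^ 2 ↔ k.val + 2 = n ^ 2 := by
  refine ⟨fun h => ?_, shift_one_val_last⟩
  have h4 := four_le_sq hn
  have hk := k.isLt
  simp only [shift] at h
  rcases lt_or_ge (k.val + 1) (n ^ 2) with h1 | h1
  · rw [Nat.mod_eq_of_lt h1] at h; omega
  · rw [Nat.mod_eq_sub_mod h1, Nat.mod_eq_of_lt (by omega)] at h; omega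

/-- The excluded `k` is the only one for which the wrapped `k + 1` is the last index; otherwise the
step from there to `k + 2` does not wrap. -/
theorem shift_two_val {n : ℕ} (hn : 2 ≤ n) {k : Idx n} (hk : k.val + 2 ≠ n ^ 2) :
    (shift k 2).val = (shift k 1).val + 1 := by
  have h4 := four_le_sq hn
  have hk' := k.isLt
  simp only [shift]
  rcases lt_or_ge (k.val + 1) (n ^ 2) with h1 | h1
  · rw [Nat.mod_eq_of_lt h1, Nat.mod_eq_of_lt (by omega)]
  · rw [Nat.mod_eq_sub_mod h1, Nat.mod_eq_sub_mod (by omega : k.val + 2 ≥ n ^ 2),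
      Nat.mod_eq_of_lt (by omega), Nat.mod_eq_of_lt (by omega)]
    omega

/-- The y-chain that ends at index `k` is the one that leaves out the number `k + 1`. Indexing the
exit by the omitted number turns the three kinds of exit edges into one relation. -/
theorem edge_y2_iff {n : ℕ} (hn : 2 ≤ n) {i j k : Idx n} {u : Vert n} :
    Edge (y i j k 2) u ↔
      u = y i j k 1 ∨ u = y i j (shift k 1) 0 ∨ BlockExit (block i j) (shift k 1) u := by
  constructor
  · generalize hw : y i j k 2 = w
    intro h
    cases h <;> simp_all
    · exact .next_number _ _ _ (shift_two_val hn ‹_›)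
    · exact .next_block _ _ _ _ (shift_one_val_last ‹_›) ‹_› ‹_›
    · exact .last _ _ _ _ (shift_one_val_last ‹_›) ‹_› ‹_› ‹_›
  · rintro (rfl | rfl | h)
    · exact Edge.y_21 i j k
    · exact Edge.y_y i j k
    · cases h with
      | next_number k' hk' =>
        have hk : k.val + 2 ≠ n ^ 2 := fun e => by
          have := shift_one_val_last e
          have := k'.isLt
          omega
        have : k' = shift k 2 := Fin.ext (by rw [hk', shift_two_val hn hk])
        rw [this]
        exact Edge.y_b i j k hk
      | next_block a' k' hk ha hk' =>
        exact Edge.y_b_next i j k a' k' ((shift_one_val_last_iff hn).1 hk) ha hk'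
      | last i' k' hk ha hi' hk' =>
        exact Edge.y_r i j k i' k' ((shift_one_val_last_iff hn).1 hk) ha hi' hk'

/-- For edges into a vertex one implication suffices, because candidates for the predecessor are
only ever ruled out. -/
theorem edge_to_x0 {n : ℕ} {i j k : Idx n} {u : Vert n} (h : Edge u (x i j k 0)) :
    u = x i j k 1 ∨ ∃ m, shift m 1 = k ∧ (u = b (block i j) m ∨ u = x i j m 2) := by
  generalize hw : x i j k 0 = w at h
  cases h <;> simp_all

theorem edge_to_x1 {n : ℕ} {i j k : Idx n} {u : Vert n} (h : Edge u (x i j k 1)) :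
    u = x i j k 0 ∨ u = x i j k 2 := by
  generalize hw : x i j k 1 = w at h
  cases h <;> simp_all

theorem edge_to_x2 {n : ℕ} {i j k : Idx n} {u : Vert n} (h : Edge u (x i j k 2)) :
    u = x i j k 1 ∨ u = r i k := by
  generalize hw : x i j k 2 = w at h
  cases h <;> simp_all

theorem edge_to_v {n : ℕ} {i j : Idx n} {u : Vert n} (h : Edge u (v i j)) :
    ∃ k, u = x i j k 0 := by
  cases h
  exact ⟨_, rfl⟩

theorem edge_to_y0 {n : ℕ} {i j k : Idx n} {u : Vert n} (h : Edge u (y i j k 0)) :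
    u = y i j k 1 ∨ ∃ m, (shift m 1 = k ∧ u = y i j m 2) ∨ (shift m 2 = k ∧ u = x i j m 2) := by
  generalize hw : y i j k 0 = w at h
  cases h <;> simp_all

theorem edge_to_y1 {n : ℕ} {i j k : Idx n} {u : Vert n} (h : Edge u (y i j k 1)) :
    u = y i j k 0 ∨ u = y i j k 2 := by
  generalize hw : y i j k 1 = w at h
  cases h <;> simp_all

theorem edge_to_y2 {n : ℕ} {i j k : Idx n} {u : Vert n} (h : Edge u (y i j k 2)) :
    u = y i j k 1 ∨ u = c j k := by
  generalize hw : y i j k 2 = w at h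
  cases h <;> simp_all

theorem edge_to_w {n : ℕ} {i j : Idx n} {u : Vert n} (h : Edge u (w i j)) :
    ∃ k, u = y i j k 0 := by
  cases h
  exact ⟨_, rfl⟩

/-! ### Every Hamiltonian cycle corresponds to exactly one filled grid -/

/-- A 2-cycle would be the whole orbit, but `s`, `f` and `t z` are three different vertices. On the
way from cycles to grids, the single orbit is used only here. -/
theorem IsHamCycle.two_cycle_free {n : ℕ} {G : Digraph (Vert n)} {σ : Equiv.Perm (Vert n)}
    (h : IsHamCycle G σ) (hn : 2 ≤ n) (u : Vert n) : σ (σ u) ≠ u := by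
  intro hu
  have h4 := four_le_sq hn
  let z : Idx n := ⟨0, by omega⟩
  have hσ : ∀ m : ℤ, (σ ^ m) u = u ∨ (σ ^ m) u = σ u := by
    intro m
    have h2 : (σ ^ (2 : ℤ)) u = u := by
      rw [zpow_ofNat, pow_two, Equiv.Perm.mul_apply, hu]
    have h2m : ∀ q : ℤ, (σ ^ (2 * q)) u = u := fun q => by
      rw [zpow_mul]
      exact Equiv.Perm.zpow_apply_eq_self_of_apply_eq_self h2 q
    rcases Int.even_or_odd' m with ⟨q, rfl | rfl⟩
    · exact Or.inl (h2m q)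
    · right
      rw [add_comm, zpow_add, Equiv.Perm.mul_apply, h2m, zpow_one]
  have key : ∀ t : Vert n, t = u ∨ t = σ u := fun t => by
    obtain ⟨m, hm⟩ := h.1.2 (Set.mem_univ u) (Set.mem_univ t)
    rw [← hm]
    exact hσ m
  rcases key s with h1 | h1 <;> rcases key f with h2 | h2 <;>
    rcases key (t z) with h3 | h3 <;>
    first
    | exact absurd (h1.trans h2.symm) (by simp)
    | exact absurd (h1.trans h3.symm) (by simp)
    | exact absurd (h2.trans h3.symm) (by simp)

/-- The middle vertex of a path of three vertices without other edges at the middle vertex is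
traversed in one of the two directions. -/
theorem triple_cases {V : Type*} {σ : Equiv.Perm V} (h2 : ∀ u, σ (σ u) ≠ u) {u₀ u₁ u₂ : V}
    (ho : σ u₁ = u₀ ∨ σ u₁ = u₂) (hi : ∀ u, σ u = u₁ → u = u₀ ∨ u = u₂) :
    (σ u₀ = u₁ ∧ σ u₁ = u₂) ∨ (σ u₂ = u₁ ∧ σ u₁ = u₀) := by
  have h1 : σ (σ.symm u₁) = u₁ := σ.apply_symm_apply u₁
  rcases hi _ h1 with h | h <;> rw [h] at h1
  · rcases ho with h3 | h3
    · exact absurd (by rw [h1, h3]) (h2 u₀)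
    · exact Or.inl ⟨h1, h3⟩
  · rcases ho with h3 | h3
    · exact Or.inr ⟨h1, h3⟩
    · exact absurd (by rw [h1, h3]) (h2 u₂)

section HamToGrid

variable {n : ℕ} {σ : Equiv.Perm (Vert n)}

theorem x_cases (he : ∀ u, Edge u (σ u)) (h2 : ∀ u, σ (σ u) ≠ u) (i j k : Idx n) :
    (σ (x i j k 0) = x i j k 1 ∧ σ (x i j k 1) = x i j k 2) ∨
      (σ (x i j k 2) = x i j k 1 ∧ σ (x i j k 1) = x i j k 0) :=
  triple_cases h2 (edge_x1_iff.1 (he _)) fun u hu => edge_to_x1 (hu ▸ he u)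

theorem y_cases (he : ∀ u, Edge u (σ u)) (h2 : ∀ u, σ (σ u) ≠ u) (i j k : Idx n) :
    (σ (y i j k 0) = y i j k 1 ∧ σ (y i j k 1) = y i j k 2) ∨
      (σ (y i j k 2) = y i j k 1 ∧ σ (y i j k 1) = y i j k 0) :=
  triple_cases h2 (edge_y1_iff.1 (he _)) fun u hu => edge_to_y1 (hu ▸ he u)

/-- The number of a position is read off from the predecessor of `v i j`. The triple of this number
is the only descending one of the position, and `r i k` can enter only descending triples, which
yields the row property. -/
theorem exists_x_grid (he : ∀ u, Edge u (σ u)) (h2 : ∀ u, σ (σ u) ≠ u) :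
    ∃ S : Grid n,
      (∀ i j, σ (r i (S i j)) = x i j (S i j) 2 ∧ σ (x i j (S i j) 2) = x i j (S i j) 1 ∧
        σ (x i j (S i j) 1) = x i j (S i j) 0 ∧ σ (x i j (S i j) 0) = v i j) ∧
      (∀ i j m, m ≠ S i j → σ (x i j m 0) = x i j m 1 ∧ σ (x i j m 1) = x i j m 2) ∧
      ∀ i k, ∃! j, S i j = k := by
  have hv : ∀ i j, ∃ k, σ (x i j k 0) = v i j := fun i j => by
    have h1 : σ (σ.symm (v i j)) = v i j := σ.apply_symm_apply _
    obtain ⟨k, hk⟩ := edge_to_v (h1 ▸ he (σ.symm (v i j)))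
    exact ⟨k, hk ▸ h1⟩
  choose S hS using hv
  -- In a descending triple the middle vertex already has the top one as predecessor, so the bottom
  -- vertex has to leave to `v i j`.
  have hdown : ∀ i j k, σ (x i j k 2) = x i j k 1 → σ (x i j k 0) = v i j := fun i j k h => by
    rcases edge_x0_iff.1 (he (x i j k 0)) with h1 | h1
    · simpa using σ.injective (h1.trans h.symm)
    · exact h1
  have huniq : ∀ i j k, σ (x i j k 2) = x i j k 1 → k = S i j := fun i j k h => by
    simpa using σ.injective ((hdown i j k h).trans (hS i j).symm)
  have hrow : ∀ i j, σ (r i (S i j)) = x i j (S i j) 2 ∧ σ (x i j (S i j) 2) = x i j (S i j) 1 ∧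
      σ (x i j (S i j) 1) = x i j (S i j) 0 ∧ σ (x i j (S i j) 0) = v i j := by
    intro i j
    rcases x_cases he h2 i j (S i j) with ⟨h, -⟩ | ⟨h, h'⟩
    · simp [hS] at h
    · refine ⟨?_, h, h', hS i j⟩
      have h1 : σ (σ.symm (x i j (S i j) 2)) = x i j (S i j) 2 := σ.apply_symm_apply _
      rcases edge_to_x2 (h1 ▸ he (σ.symm (x i j (S i j) 2))) with h3 | h3 <;> rw [h3] at h1
      · simp [h'] at h1
      · exact h1
  refine ⟨S, hrow, ?_, ?_⟩
  · intro i j m hm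
    rcases x_cases he h2 i j m with h | ⟨h, -⟩
    · exact h
    · exact absurd (huniq i j m h) hm
  · intro i k
    obtain ⟨j, hj⟩ := edge_r_iff.1 (he (r i k))
    refine ⟨j, ?_, ?_⟩
    -- If this triple ascended, its top vertex would have both the middle vertex and `r i k` as
    -- predecessors.
    · rcases x_cases he h2 i j k with ⟨-, h⟩ | ⟨h, -⟩
      · simpa using σ.injective (h.trans hj.symm)
      · exact (huniq i j k h).symm
    · rintro j' rfl
      have := (hrow i j').1.symm.trans hj
      simp only [Vert.x.injEq] at this
      exact this.2.1

/-- The mirror image of `exists_x_grid`, with columns for rows. That the two grids coincide is not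
visible at this stage. -/
theorem exists_y_grid (he : ∀ u, Edge u (σ u)) (h2 : ∀ u, σ (σ u) ≠ u) :
    ∃ S : Grid n,
      (∀ i j, σ (c j (S i j)) = y i j (S i j) 2 ∧ σ (y i j (S i j) 2) = y i j (S i j) 1 ∧
        σ (y i j (S i j) 1) = y i j (S i j) 0 ∧ σ (y i j (S i j) 0) = w i j) ∧
      (∀ i j m, m ≠ S i j → σ (y i j m 0) = y i j m 1 ∧ σ (y i j m 1) = y i j m 2) ∧
      ∀ j k, ∃! i, S i j = k := by
  have hv : ∀ i j, ∃ k, σ (y i j k 0) = w i j := fun i j => by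
    have h1 : σ (σ.symm (w i j)) = w i j := σ.apply_symm_apply _
    obtain ⟨k, hk⟩ := edge_to_w (h1 ▸ he (σ.symm (w i j)))
    exact ⟨k, hk ▸ h1⟩
  choose S hS using hv
  have hdown : ∀ i j k, σ (y i j k 2) = y i j k 1 → σ (y i j k 0) = w i j := fun i j k h => by
    rcases edge_y0_iff.1 (he (y i j k 0)) with h1 | h1
    · simpa using σ.injective (h1.trans h.symm)
    · exact h1
  have huniq : ∀ i j k, σ (y i j k 2) = y i j k 1 → k = S i j := fun i j k h => by
    simpa using σ.injective ((hdown i j k h).trans (hS i j).symm)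
  have hcol : ∀ i j, σ (c j (S i j)) = y i j (S i j) 2 ∧ σ (y i j (S i j) 2) = y i j (S i j) 1 ∧
      σ (y i j (S i j) 1) = y i j (S i j) 0 ∧ σ (y i j (S i j) 0) = w i j := by
    intro i j
    rcases y_cases he h2 i j (S i j) with ⟨h, -⟩ | ⟨h, h'⟩
    · simp [hS] at h
    · refine ⟨?_, h, h', hS i j⟩
      have h1 : σ (σ.symm (y i j (S i j) 2)) = y i j (S i j) 2 := σ.apply_symm_apply _
      rcases edge_to_y2 (h1 ▸ he (σ.symm (y i j (S i j) 2))) with h3 | h3 <;> rw [h3] at h1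
      · simp [h'] at h1
      · exact h1
  refine ⟨S, hcol, ?_, ?_⟩
  · intro i j m hm
    rcases y_cases he h2 i j m with h | ⟨h, -⟩
    · exact h
    · exact absurd (huniq i j m h) hm
  · intro j k
    obtain ⟨i, hi⟩ := edge_c_iff.1 (he (c j k))
    refine ⟨i, ?_, ?_⟩
    · rcases y_cases he h2 i j k with ⟨-, h⟩ | ⟨h, -⟩
      · simpa using σ.injective (h.trans hi.symm)
      · exact (huniq i j k h).symm
    · rintro i' rfl
      have := (hcol i' j).1.symm.trans hi
      simp only [Vert.y.injEq] at this
      exact this.1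

/-- The directions of the triples occupy so many vertices that every remaining successor is forced.
The argument runs along the chain of a position, mostly by asking which predecessors are still free.
-/
theorem exists_corresponds (hn : 2 ≤ n) (he : ∀ u, Edge u (σ u)) (h2 : ∀ u, σ (σ u) ≠ u) :
    ∃ S : Grid n, Corresponds σ S ∧ IsSudoku S := by
  have h4 := four_le_sq hn
  obtain ⟨S, hrow, hxup, hSrow⟩ := exists_x_grid he h2
  obtain ⟨T, hcol, hyup, hTcol⟩ := exists_y_grid he h2
  have hs1 : ∀ k : Idx n, shift k 1 ≠ k := fun k => shift_ne k (by omega) (by omega)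
  have hsp : ∀ k : Idx n, shift k (n ^ 2 - 1) ≠ k := fun k => shift_ne k (by omega) (by omega)
  have hsp1 : ∀ k : Idx n, shift (shift k (n ^ 2 - 1)) 1 = k := fun k => by
    rw [shift_pred_succ k 0, shift_zero]
  have hsp2 : ∀ k : Idx n, shift (shift k (n ^ 2 - 1)) 2 = shift k 1 := fun k =>
    shift_pred_succ k 1
  -- Of the three possible predecessors, the middle vertex of the same triple goes up and the top
  -- vertex of the triple of `S i j` goes down; only the block vertex remains.
  have hbx : ∀ i j, σ (b (block i j) (S i j)) = x i j (shift (S i j) 1) 0 := by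
    intro i j
    have h1 := σ.apply_symm_apply (x i j (shift (S i j) 1) 0)
    rcases edge_to_x0 (h1 ▸ he (σ.symm (x i j (shift (S i j) 1) 0))) with h | ⟨m, hm, h | h⟩ <;>
      rw [h] at h1
    · rw [(hxup i j _ (hs1 _)).2] at h1
      simp at h1
    · rw [shift_inj.1 hm] at h1
      exact h1
    · rw [shift_inj.1 hm, (hrow i j).2.1] at h1
      simp at h1
  -- Two positions of one block with the same number would give one block vertex two successors.
  -- Positions and pairs (block, number) are equally many, so the map is even bijective.
  have hinj : Function.Injective fun p : Idx n × Idx n => (block p.1 p.2, S p.1 p.2) := by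
    rintro ⟨i, j⟩ ⟨i', j'⟩ h
    simp only [Prod.mk.injEq] at h
    have h1 := hbx i j
    rw [h.1, h.2, hbx i' j'] at h1
    simp only [Vert.x.injEq] at h1
    simp [h1.1, h1.2.1]
  have hbij := Finite.injective_iff_bijective.1 hinj
  have hblk : ∀ a k : Idx n, ∃! p : Idx n × Idx n, block p.1 p.2 = a ∧ S p.1 p.2 = k := by
    intro a k
    simpa [Prod.ext_iff] using hbij.existsUnique (a, k)
  have hxx : ∀ i j m, m ≠ S i j → shift m 1 ≠ S i j → σ (x i j m 2) = x i j (shift m 1) 0 := by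
    intro i j m hm hm1
    have h1 := σ.apply_symm_apply (x i j (shift m 1) 0)
    rcases edge_to_x0 (h1 ▸ he (σ.symm (x i j (shift m 1) 0))) with h | ⟨q, hq, h | h⟩ <;>
      rw [h] at h1
    · rw [(hxup i j _ hm1).2] at h1
      simp at h1
    · rw [shift_inj.1 hq] at h1
      -- The vertex `b (block i j) m` is taken by the position of the block holding `m`, which is
      -- not `(i, j)`.
      obtain ⟨⟨i', j'⟩, ⟨ha, hk⟩, -⟩ := hblk (block i j) m
      have h3 := hbx i' j'
      simp only at ha hk
      rw [ha, hk, h1] at h3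
      simp only [Vert.x.injEq] at h3
      rw [← h3.1, ← h3.2.1] at hk
      exact absurd hk.symm hm
    · rwa [shift_inj.1 hq] at h1
  have hxy : ∀ i j, σ (x i j (shift (S i j) (n ^ 2 - 1)) 2) = y i j (shift (S i j) 1) 0 := by
    intro i j
    -- Going back down would be a 2-cycle, and the bottom vertex of the triple of `S i j` is entered
    -- from its middle vertex.
    rcases edge_x2_iff.1 (he (x i j (shift (S i j) (n ^ 2 - 1)) 2)) with h | h | h
    · exact absurd (by rw [h, (hxup i j _ (hsp _)).2]) (h2 (x i j (shift (S i j) (n ^ 2 - 1)) 2))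
    · rw [hsp1, ← (hrow i j).2.2.1] at h
      simpa using σ.injective h
    · rwa [hsp2] at h
  -- If the grids differ at `(i, j)`, the bottom vertex of the y-triple after `T i j` has no
  -- predecessor left: the y-candidates are occupied, and the only x-candidate, at index `T i j -
  -- 1`, either descends or continues to the x-triple of `T i j`.
  have hTS : T = S := by
    funext i j
    by_contra hne
    have h1 := σ.apply_symm_apply (y i j (shift (T i j) 1) 0)
    rcases edge_to_y0 (h1 ▸ he (σ.symm (y i j (shift (T i j) 1) 0))) with
      h | ⟨m, ⟨hm, h⟩ | ⟨hm, h⟩⟩ <;> rw [h] at h1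
    · rw [(hyup i j _ (hs1 _)).2] at h1
      simp at h1
    · rw [shift_inj.1 hm, (hcol i j).2.1] at h1
      simp at h1
    · have hm1 : shift m 1 = T i j := by
        rwa [← shift_inj (c := 1), shift_shift]
      by_cases hmS : m = S i j
      · rw [hmS, (hrow i j).2.1] at h1
        simp at h1
      · rw [hxx i j m hmS (hm1 ▸ hne)] at h1
        simp at h1
  subst hTS
  refine ⟨T, ⟨hbx, hxup, hxx, hxy, hyup, ?_, ?_, hrow, hcol⟩, ⟨hSrow, hTcol, hblk⟩⟩
  · intro i j m hm hm1
    have h1 := σ.apply_symm_apply (y i j (shift m 1) 0)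
    rcases edge_to_y0 (h1 ▸ he (σ.symm (y i j (shift m 1) 0))) with
      h | ⟨q, ⟨hq, h⟩ | ⟨hq, h⟩⟩ <;> rw [h] at h1
    · rw [(hyup i j _ hm1).2] at h1
      simp at h1
    · rwa [shift_inj.1 hq] at h1
    · have hq1 : shift q 1 = m := by
        rwa [← shift_inj (c := 1), shift_shift]
      by_cases hqS : q = T i j
      · rw [hqS, (hrow i j).2.1] at h1
        simp at h1
      · rw [hxx i j q hqS (hq1 ▸ hm)] at h1
        simp at h1
  · intro i j
    rcases (edge_y2_iff hn).1 (he (y i j (shift (T i j) (n ^ 2 - 1)) 2)) with h | h | h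
    · exact absurd (by rw [h, (hyup i j _ (hsp _)).2]) (h2 (y i j (shift (T i j) (n ^ 2 - 1)) 2))
    · rw [hsp1, ← (hcol i j).2.2.1] at h
      simpa using σ.injective h
    · rwa [hsp1] at h

end HamToGrid

/-- The predecessor of `v i j` reveals the number in position `(i, j)`. -/
theorem Corresponds.unique {n : ℕ} {σ : Equiv.Perm (Vert n)} {S T : Grid n}
    (hS : Corresponds σ S) (hT : Corresponds σ T) : S = T := by
  funext i j
  simpa using σ.injective ((hS.row i j).2.2.2.trans (hT.row i j).2.2.2.symm)

/-! ### Every valid solution corresponds to a Hamiltonian cycle -/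

/-- The first index, given that there is some index. -/
def first {n : ℕ} (k : Idx n) : Idx n := ⟨0, k.pos⟩

theorem eq_first {n : ℕ} {k : Idx n} (h : k.val = 0) (m : Idx n) : k = first m := Fin.ext h

/-- `g` at the index after `k`, and `u` if `k` is the last index. -/
def succOr {n : ℕ} {V : Type*} (k : Idx n) (g : Idx n → V) (u : V) : V :=
  if h : k.val + 1 < n ^ 2 then g ⟨k.val + 1, h⟩ else u

/-- The vertex visited once number `k` has been placed in block `a`. -/
def blockNext {n : ℕ} (a k : Idx n) : Vert n :=
  succOr k (b a) (succOr a (fun a' => b a' (first k)) (r (first k) (first k)))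

theorem blockExit_iff {n : ℕ} {a k : Idx n} {u : Vert n} :
    BlockExit a k u ↔ u = blockNext a k := by
  have hk := k.isLt
  have ha := a.isLt
  constructor
  · intro h
    cases h with
    | next_number k' hk' =>
      have h1 := k'.isLt
      rw [blockNext, succOr, dif_pos (by omega)]
      congr 1
      exact Fin.ext hk'
    | next_block a' k' hk1 ha' hk' =>
      have h1 := a'.isLt
      rw [blockNext, succOr, dif_neg (by omega), succOr, dif_pos (by omega), eq_first hk' k]
      congr 1
      exact Fin.ext ha'
    | last i' k' hk1 ha1 hi' hk' =>
      rw [blockNext, succOr, dif_neg (by omega), succOr, dif_neg (by omega), eq_first hk' k,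
        eq_first hi' k]
  · rintro rfl
    rw [blockNext, succOr]
    split_ifs with h1
    · exact .next_number _ _ _ rfl
    · rw [succOr]
      split_ifs with h2
      · exact .next_block _ _ _ _ (by omega) rfl rfl
      · exact .last _ _ _ _ (by omega) (by omega) rfl rfl

/-- Induction along a chain `g 0, g 1, …` followed by `u`. It serves for the numbers within a block,
row or column as well as for the sequences of blocks, rows and columns. -/
theorem succOr_induction {n : ℕ} {V : Type*} {R : V → Prop} {z : Idx n} (hz : z.val = 0)
    {g : Idx n → V} {u : V} (h0 : R (g z)) (hstep : ∀ k, R (g k) → R (succOr k g u)) :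
    (∀ k, R (g k)) ∧ R u := by
  have h : ∀ m (hm : m < n ^ 2), R (g ⟨m, hm⟩) := by
    intro m
    induction m with
    | zero =>
      intro hm
      rwa [show (⟨0, hm⟩ : Idx n) = z from Fin.ext hz.symm]
    | succ m ih =>
      intro hm
      have := hstep _ (ih (by omega))
      rwa [succOr, dif_pos hm] at this
  have hp := z.pos
  refine ⟨fun k => h k.val k.isLt, ?_⟩
  have := hstep _ (h (n ^ 2 - 1) (by omega))
  rwa [succOr, dif_neg (by simp only; omega)] at this

section GridToHam

variable {n : ℕ} {S : Grid n}

/-- The vertex that follows `u` in the Hamiltonian cycle of a valid solution `S`. -/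
noncomputable def next (z : Idx n) (hS : IsSudoku S) : Vert n → Vert n
  | .s => b z z
  | .f => s
  | .b a k => x (hS.blk a k).choose.1 (hS.blk a k).choose.2 (shift k 1) 0
  | .r i k => x i (hS.row i k).choose k 2
  | .t i => succOr i (fun i' => r i' z) (c z z)
  | .c j k => y (hS.col j k).choose j k 2
  | .d j => succOr j (fun j' => c j' z) f
  | .x i j k l =>
    if k = S i j then (if l = 0 then v i j else if l = 1 then x i j k 0 else x i j k 1)
    else if l = 0 then x i j k 1
    else if l = 1 then x i j k 2
    else if shift k 1 = S i j then y i j (shift k 2) 0 else x i j (shift k 1) 0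
  | .v i j => succOr (S i j) (r i) (t i)
  | .y i j k l =>
    if k = S i j then (if l = 0 then w i j else if l = 1 then y i j k 0 else y i j k 1)
    else if l = 0 then y i j k 1
    else if l = 1 then y i j k 2
    else if shift k 1 = S i j then blockNext (block i j) (S i j) else y i j (shift k 1) 0
  | .w i j => succOr (S i j) (c j) (d j)

theorem next_b (z : Idx n) (hS : IsSudoku S) (i j : Idx n) :
    next z hS (b (block i j) (S i j)) = x i j (shift (S i j) 1) 0 := by
  have h := (hS.blk (block i j) (S i j)).choose_spec
  have h1 : (i, j) = (hS.blk (block i j) (S i j)).choose := h.2 (i, j) ⟨rfl, rfl⟩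
  simp only [next, ← h1]

theorem next_r (z : Idx n) (hS : IsSudoku S) (i j : Idx n) :
    next z hS (r i (S i j)) = x i j (S i j) 2 := by
  have h1 : j = (hS.row i (S i j)).choose := (hS.row i (S i j)).choose_spec.2 j rfl
  simp only [next, ← h1]

theorem next_c (z : Idx n) (hS : IsSudoku S) (i j : Idx n) :
    next z hS (c j (S i j)) = y i j (S i j) 2 := by
  have h1 : i = (hS.col j (S i j)).choose := (hS.col j (S i j)).choose_spec.2 i rfl
  simp only [next, ← h1]

theorem edge_next (hn : 2 ≤ n) {z : Idx n} (hz : z.val = 0) (hS : IsSudoku S) (u : Vert n) :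
    Edge u (next z hS u) := by
  cases u with
  | s => exact .s_b z z hz hz
  | f => exact .f_s
  | b a k => exact edge_b_iff.2 ⟨_, _, (hS.blk a k).choose_spec.1.1, rfl⟩
  | r i k => exact edge_r_iff.2 ⟨_, rfl⟩
  | t i =>
    simp only [next, succOr]
    split_ifs with h
    · exact .t_r _ _ _ rfl hz
    · exact .t_c _ _ _ (by have := i.isLt; omega) hz hz
  | c j k => exact edge_c_iff.2 ⟨_, rfl⟩
  | d j =>
    simp only [next, succOr]
    split_ifs with h
    · exact .d_c _ _ _ rfl hz
    · exact .d_f _ (by have := j.isLt; omega)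
  | x i j k l =>
    fin_cases l
    · change Edge (x i j k 0) _
      rw [edge_x0_iff]
      simp only [next]
      split_ifs <;> simp_all
    · change Edge (x i j k 1) _
      rw [edge_x1_iff]
      simp only [next]
      split_ifs <;> simp_all
    · change Edge (x i j k 2) _
      rw [edge_x2_iff]
      simp only [next]
      split_ifs <;> simp_all
  | v i j =>
    simp only [next, succOr]
    split_ifs
    · exact .v_r _ _ _
    · exact .v_t _ _
  | y i j k l =>
    fin_cases l
    · change Edge (y i j k 0) _
      rw [edge_y0_iff]
      simp only [next]
      split_ifs <;> simp_all
    · change Edge (y i j k 1) _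
      rw [edge_y1_iff]
      simp only [next]
      split_ifs <;> simp_all
    · change Edge (y i j k 2) _
      rw [edge_y2_iff hn, blockExit_iff]
      simp only [next]
      split_ifs <;> simp_all
  | w i j =>
    simp only [next, succOr]
    split_ifs
    · exact .w_c _ _ _
    · exact .w_d _ _

/-- The part of the walk that places one number in its block: all x-triples and then all y-triples
of the position are passed, except those of the number itself. For `R`, reachability from `s` is
intended. -/
theorem reach_cell (hn : 2 ≤ n) {z : Idx n} {hS : IsSudoku S} {R : Vert n → Prop}
    (hR : ∀ u, R u → R (next z hS u)) (i j : Idx n) (h : R (b (block i j) (S i j))) :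
    (∀ m, m ≠ S i j → ∀ l, R (x i j m l) ∧ R (y i j m l)) ∧
      R (blockNext (block i j) (S i j)) := by
  have h4 := four_le_sq hn
  have hlast : shift (shift (S i j) (n ^ 2 - 1)) 1 = S i j := by
    rw [shift_pred_succ _ 0, shift_zero]
  have hX : ∀ m, m ≠ S i j → R (x i j m 0) → R (x i j m 1) ∧ R (x i j m 2) := by
    intro m hm h0
    have h1 : R (x i j m 1) := by simpa [next, hm] using hR _ h0
    exact ⟨h1, by simpa [next, hm] using hR _ h1⟩
  have hY : ∀ m, m ≠ S i j → R (y i j m 0) → R (y i j m 1) ∧ R (y i j m 2) := by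
    intro m hm h0
    have h1 : R (y i j m 1) := by simpa [next, hm] using hR _ h0
    exact ⟨h1, by simpa [next, hm] using hR _ h1⟩
  have hx : ∀ q, q + 1 < n ^ 2 → R (x i j (shift (S i j) (q + 1)) 0) := by
    intro q
    induction q with
    | zero =>
      intro _
      have := hR _ h
      rwa [next_b] at this
    | succ q ih =>
      intro hq
      have hne := shift_ne (S i j) (c := q + 1) (by omega) (by omega)
      have hne' := shift_ne (S i j) (c := q + 1 + 1) (by omega) (by omega)
      simpa [next, hne, hne', shift_shift] using hR _ (hX _ hne (ih (by omega))).2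
  have hy : ∀ q, q + 1 < n ^ 2 → R (y i j (shift (S i j) (q + 1)) 0) := by
    intro q
    induction q with
    | zero =>
      intro _
      -- The x-chain ends at offset `n ^ 2 - 1`, just before `S i j`; the jump by two skips this
      -- number and starts the y-chain at offset 1.
      have hne := shift_ne (S i j) (c := n ^ 2 - 2 + 1) (by omega) (by omega)
      have h1 := hR _ (hX _ hne (hx (n ^ 2 - 2) (by omega))).2
      rw [show n ^ 2 - 2 + 1 = n ^ 2 - 1 by omega] at hne h1
      simpa [next, hne, hlast, shift_pred_succ _ 1] using h1
    | succ q ih =>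
      intro hq
      have hne := shift_ne (S i j) (c := q + 1) (by omega) (by omega)
      have hne' := shift_ne (S i j) (c := q + 1 + 1) (by omega) (by omega)
      simpa [next, hne, hne', shift_shift] using hR _ (hY _ hne (ih (by omega))).2
  constructor
  · intro m hm l
    obtain ⟨q, hq, rfl⟩ := exists_shift_of_ne hm
    have h1 := hx q hq
    have h2 := hy q hq
    have h3 := hX _ hm h1
    have h5 := hY _ hm h2
    fin_cases l
    exacts [⟨h1, h2⟩, ⟨h3.1, h5.1⟩, ⟨h3.2, h5.2⟩]
  · have hne := shift_ne (S i j) (c := n ^ 2 - 2 + 1) (by omega) (by omega)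
    have h1 := hR _ (hY _ hne (hy (n ^ 2 - 2) (by omega))).2
    rw [show n ^ 2 - 2 + 1 = n ^ 2 - 1 by omega] at hne h1
    simpa [next, hne, hlast] using h1

/-- Blocks, rows and columns are traversed one after the other, each phase ending where the next one
starts. A chain can always be continued because each number has a position in each block, row and
column. Triples of the numbers of `S` are left to the row and column phases. -/
theorem reach_all (hn : 2 ≤ n) {z : Idx n} (hz : z.val = 0) {hS : IsSudoku S}
    {R : Vert n → Prop} (hR : ∀ u, R u → R (next z hS u)) (h0 : R s) : ∀ u, R u := by
  have hblock : ∀ a, R (b a z) → (∀ k, R (b a k)) ∧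
      R (succOr a (fun a' => b a' z) (r z z)) := by
    intro a ha
    refine succOr_induction hz ha fun k hk => ?_
    obtain ⟨⟨i, j⟩, ⟨rfl, rfl⟩, -⟩ := hS.blk a k
    have := (reach_cell hn hR i j hk).2
    rwa [blockNext, ← eq_first hz] at this
  have hblocks := succOr_induction (R := R) (g := fun a => b a z) hz (hR _ h0)
    fun a ha => (hblock a ha).2
  have hb : ∀ a k, R (b a k) := fun a => (hblock a (hblocks.1 a)).1
  have hrx : ∀ i j, R (r i (S i j)) →
      (∀ l, R (x i j (S i j) l)) ∧ R (v i j) ∧ R (succOr (S i j) (r i) (t i)) := by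
    intro i j h
    have h2 := hR _ h
    rw [next_r] at h2
    have h1 : R (x i j (S i j) 1) := by simpa [next] using hR _ h2
    have h0 : R (x i j (S i j) 0) := by simpa [next] using hR _ h1
    have hv : R (v i j) := by simpa [next] using hR _ h0
    refine ⟨fun l => ?_, hv, hR _ hv⟩
    fin_cases l
    exacts [h0, h1, h2]
  have hcy : ∀ i j, R (c j (S i j)) →
      (∀ l, R (y i j (S i j) l)) ∧ R (w i j) ∧ R (succOr (S i j) (c j) (d j)) := by
    intro i j h
    have h2 := hR _ h
    rw [next_c] at h2
    have h1 : R (y i j (S i j) 1) := by simpa [next] using hR _ h2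
    have h0 : R (y i j (S i j) 0) := by simpa [next] using hR _ h1
    have hw : R (w i j) := by simpa [next] using hR _ h0
    refine ⟨fun l => ?_, hw, hR _ hw⟩
    fin_cases l
    exacts [h0, h1, h2]
  have hrow : ∀ i, R (r i z) → (∀ k, R (r i k)) ∧ R (t i) := by
    intro i hi
    refine succOr_induction hz hi fun k hk => ?_
    obtain ⟨j, rfl, -⟩ := hS.row i k
    exact (hrx i j hk).2.2
  have hrows := succOr_induction (R := R) (g := fun i => r i z) hz hblocks.2
    fun i hi => hR _ (hrow i hi).2
  have hr : ∀ i k, R (r i k) := fun i => (hrow i (hrows.1 i)).1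
  have hcol : ∀ j, R (c j z) → (∀ k, R (c j k)) ∧ R (d j) := by
    intro j hj
    refine succOr_induction hz hj fun k hk => ?_
    obtain ⟨i, rfl, -⟩ := hS.col j k
    exact (hcy i j hk).2.2
  have hcols := succOr_induction (R := R) (g := fun j => c j z) hz hrows.2
    fun j hj => hR _ (hcol j hj).2
  have hc : ∀ j k, R (c j k) := fun j => (hcol j (hcols.1 j)).1
  intro u
  cases u with
  | s => exact h0
  | f => exact hcols.2
  | b a k => exact hb a k
  | r i k => exact hr i k
  | t i => exact (hrow i (hrows.1 i)).2
  | c j k => exact hc j k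
  | d j => exact (hcol j (hcols.1 j)).2
  | x i j k l =>
    by_cases hk : k = S i j
    · subst hk
      exact (hrx i j (hr _ _)).1 l
    · exact ((reach_cell hn hR i j (hb _ _)).1 k hk l).1
  | v i j => exact (hrx i j (hr _ _)).2.1
  | y i j k l =>
    by_cases hk : k = S i j
    · subst hk
      exact (hcy i j (hc _ _)).1 l
    · exact ((reach_cell hn hR i j (hb _ _)).1 k hk l).2
  | w i j => exact (hcy i j (hc _ _)).2.1

/-- The vertices as a sum of products of index types. -/
def vertEquiv (n : ℕ) : Vert n ≃
    (Unit ⊕ Unit) ⊕ (Idx n × Idx n) ⊕ (Idx n × Idx n) ⊕ Idx n ⊕ (Idx n × Idx n) ⊕ Idx n ⊕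
      (Idx n × Idx n × Idx n × Fin 3) ⊕ (Idx n × Idx n) ⊕ (Idx n × Idx n × Idx n × Fin 3) ⊕
        (Idx n × Idx n) where
  toFun
    | .s => .inl (.inl ())
    | .f => .inl (.inr ())
    | .b a k => .inr (.inl (a, k))
    | .r i k => .inr (.inr (.inl (i, k)))
    | .t i => .inr (.inr (.inr (.inl i)))
    | .c j k => .inr (.inr (.inr (.inr (.inl (j, k)))))
    | .d j => .inr (.inr (.inr (.inr (.inr (.inl j)))))
    | .x i j k l => .inr (.inr (.inr (.inr (.inr (.inr (.inl (i, j, k, l)))))))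
    | .v i j => .inr (.inr (.inr (.inr (.inr (.inr (.inr (.inl (i, j))))))))
    | .y i j k l => .inr (.inr (.inr (.inr (.inr (.inr (.inr (.inr (.inl (i, j, k, l)))))))))
    | .w i j => .inr (.inr (.inr (.inr (.inr (.inr (.inr (.inr (.inr (i, j)))))))))
  invFun
    | .inl (.inl ()) => s
    | .inl (.inr ()) => f
    | .inr (.inl (a, k)) => b a k
    | .inr (.inr (.inl (i, k))) => r i k
    | .inr (.inr (.inr (.inl i))) => t i
    | .inr (.inr (.inr (.inr (.inl (j, k))))) => c j k
    | .inr (.inr (.inr (.inr (.inr (.inl j))))) => d j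
    | .inr (.inr (.inr (.inr (.inr (.inr (.inl (i, j, k, l))))))) => x i j k l
    | .inr (.inr (.inr (.inr (.inr (.inr (.inr (.inl (i, j)))))))) => v i j
    | .inr (.inr (.inr (.inr (.inr (.inr (.inr (.inr (.inl (i, j, k, l))))))))) => y i j k l
    | .inr (.inr (.inr (.inr (.inr (.inr (.inr (.inr (.inr (i, j))))))))) => w i j
  left_inv u := by cases u <;> rfl
  right_inv u := by
    rcases u with (_ | _) | _ | _ | _ | _ | _ | _ | _ | _ | _ <;> rfl

instance (n : ℕ) : Finite (Vert n) := Finite.of_equiv _ (vertEquiv n).symm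

theorem card_vert (n : ℕ) :
    Nat.card (Vert n) = 6 * (n ^ 2) ^ 3 + 5 * (n ^ 2) ^ 2 + 2 * n ^ 2 + 2 := by
  rw [Nat.card_congr (vertEquiv n)]
  simp only [Nat.card_eq_fintype_card, Fintype.card_sum, Fintype.card_prod, Fintype.card_fin,
    Fintype.card_unit]
  ring

/-- Injectivity need not be checked: reachability of all vertices from `s` gives surjectivity,
finiteness gives bijectivity, and the orbit of `s` is everything. -/
theorem exists_hamCycle (hn : 2 ≤ n) {z : Idx n} (hz : z.val = 0) (hS : IsSudoku S) :
    ∃ σ : Equiv.Perm (Vert n), IsHamCycle (blankGraph n) σ ∧ ∀ u, σ u = next z hS u := by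
  have hreach : ∀ u, ∃ m : ℕ, (next z hS)^[m] s = u := by
    refine reach_all hn hz (hS := hS) ?_ ⟨0, rfl⟩
    rintro _ ⟨m, rfl⟩
    exact ⟨m + 1, Function.iterate_succ_apply' _ _ _⟩
  have hsurj : Function.Surjective (next z hS) := by
    intro u
    obtain ⟨m, hm⟩ := hreach u
    cases m with
    -- Here the vertex is `s` itself, which is the successor of `f`.
    | zero => exact ⟨f, hm⟩
    | succ m => exact ⟨_, (Function.iterate_succ_apply' _ _ _).symm.trans hm⟩
  let σ : Equiv.Perm (Vert n) :=
    Equiv.ofBijective (next z hS) (Finite.surjective_iff_bijective.1 hsurj)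
  have hσ : ∀ u, σ.SameCycle s u := by
    intro u
    obtain ⟨m, hm⟩ := hreach u
    refine ⟨m, ?_⟩
    rw [zpow_natCast, ← hm, Equiv.Perm.coe_pow]
    rfl
  refine ⟨σ, ⟨⟨by simpa using σ.bijective, fun u _ u' _ => (hσ u).symm.trans (hσ u')⟩, ?_⟩,
    fun u => rfl⟩
  exact fun u => edge_next hn hz hS u

theorem corresponds_of_next (hn : 2 ≤ n) {z : Idx n} (hS : IsSudoku S)
    {σ : Equiv.Perm (Vert n)} (hσ : ∀ u, σ u = next z hS u) : Corresponds σ S := by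
  have h4 := four_le_sq hn
  have hsp : ∀ k : Idx n, shift k (n ^ 2 - 1) ≠ k := fun k => shift_ne k (by omega) (by omega)
  have hsp1 : ∀ k : Idx n, shift (shift k (n ^ 2 - 1)) 1 = k := fun k => by
    rw [shift_pred_succ k 0, shift_zero]
  refine ⟨?_, ?_, ?_, ?_, ?_, ?_, ?_, ?_, ?_⟩ <;> simp only [hσ]
  · exact next_b z hS
  · intro i j m hm
    simp [next, hm]
  · intro i j m hm hm1
    simp [next, hm, hm1]
  · intro i j
    simp [next, hsp, hsp1, shift_pred_succ _ 1]
  · intro i j m hm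
    simp [next, hm]
  · intro i j m hm hm1
    simp [next, hm, hm1]
  · intro i j
    rw [blockExit_iff]
    simp [next, hsp, hsp1]
  · intro i j
    refine ⟨next_r z hS i j, ?_⟩
    simp [next]
  · intro i j
    refine ⟨next_c z hS i j, ?_⟩
    simp [next]

/-! ### Instances with fixed numbers -/

/-- The cycle of `S` uses an edge of one of the removable kinds, for position `(i, j)` and number
`k`, only if `S i j = k`. This is shown for each kind; a removed edge would thus give a position two
numbers, or a number two positions in a block, row or column. -/
theorem not_redundant_next {P : Puzzle n} {z : Idx n} (hS : IsSudoku S)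
    (hP : ∀ i j k, P i j = some k → S i j = k) (u : Vert n) :
    ¬ Redundant P u (next z hS u) := by
  have hblk : ∀ i j i' j', block i' j' = block i j → S i' j' = S i j → (i', j') = (i, j) :=
    fun i j i' j' h1 h2 => (hS.blk (block i j) (S i j)).unique ⟨h1, h2⟩ ⟨rfl, rfl⟩
  have hsp1 : ∀ k : Idx n, shift (shift k (n ^ 2 - 1)) 1 = k := fun k => by
    rw [shift_pred_succ k 0, shift_zero]
  have hb : ∀ i' j' a k q, next z hS (b a k) = x i' j' q 0 → S i' j' = k := by
    intro i' j' a k q h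
    have h1 := (hS.blk a k).choose_spec.1.2
    simp only [next, Vert.x.injEq] at h
    rwa [h.1, h.2.1] at h1
  have hx : ∀ i j k q, next z hS (x i j (shift k (n ^ 2 - 1)) 2) = y i j q 0 → S i j = k := by
    intro i j k q h
    by_contra hne
    by_cases h1 : shift k (n ^ 2 - 1) = S i j <;> simp [next, hsp1, Ne.symm hne, h1] at h
  have hy : ∀ i j a k, BlockExit a k (next z hS (y i j (shift k (n ^ 2 - 1)) 2)) → S i j = k := by
    intro i j a k h
    by_contra hne
    -- Otherwise the successor is a y-vertex, and a block is never left to a y-vertex.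
    by_cases h1 : shift k (n ^ 2 - 1) = S i j <;> simp [next, hsp1, Ne.symm hne, h1] at h <;>
      cases h
  have hr : ∀ i j k, next z hS (r i k) = x i j k 2 → S i j = k := by
    intro i j k h
    have h1 := (hS.row i k).choose_spec.1
    simp only [next, Vert.x.injEq] at h
    rwa [h.2.1] at h1
  have hc : ∀ i j k, next z hS (c j k) = y i j k 2 → S i j = k := by
    intro i j k h
    have h1 := (hS.col j k).choose_spec.1
    simp only [next, Vert.y.injEq] at h
    rwa [h.1] at h1
  have hv : ∀ i j k, next z hS (x i j k 0) = v i j → S i j = k := by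
    intro i j k h
    by_contra hne
    simp [next, Ne.symm hne] at h
  have hw : ∀ i j k, next z hS (y i j k 0) = w i j → S i j = k := by
    intro i j k h
    by_contra hne
    simp [next, Ne.symm hne] at h
  intro h
  generalize hu : next z hS u = u' at h
  cases h with
  | blk_b i j k i' j' hk hbl hne =>
    exact hne (hblk _ _ _ _ hbl ((hb _ _ _ _ _ hu).trans (hP _ _ _ hk).symm))
  | blk_x i j k i' j' hk hbl hne =>
    exact hne (hblk _ _ _ _ hbl ((hx _ _ _ _ hu).trans (hP _ _ _ hk).symm))
  | blk_y i j k i' j' _ hk hbl hne he =>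
    exact hne (hblk _ _ _ _ hbl ((hy _ _ _ _ (hu ▸ he)).trans (hP _ _ _ hk).symm))
  | cell_b i j k m hk hm => exact hm ((hb _ _ _ _ _ hu).symm.trans (hP _ _ _ hk))
  | cell_x i j k m hk hm => exact hm ((hx _ _ _ _ hu).symm.trans (hP _ _ _ hk))
  | cell_y i j k m _ hk hm he => exact hm ((hy _ _ _ _ (hu ▸ he)).symm.trans (hP _ _ _ hk))
  | cell_r i j k m hk hm => exact hm ((hr _ _ _ hu).symm.trans (hP _ _ _ hk))
  | cell_c i j k m hk hm => exact hm ((hc _ _ _ hu).symm.trans (hP _ _ _ hk))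
  | row_r i j k j' hk hj => exact hj ((hS.row i k).unique (hr _ _ _ hu) (hP _ _ _ hk))
  | row_v i j k j' hk hj => exact hj ((hS.row i k).unique (hv _ _ _ hu) (hP _ _ _ hk))
  | col_c i j k i' hk hi => exact hi ((hS.col j k).unique (hc _ _ _ hu) (hP _ _ _ hk))
  | col_w i j k i' hk hi => exact hi ((hS.col j k).unique (hw _ _ _ hu) (hP _ _ _ hk))

end GridToHam

/-- For the way back to a solution, a single kind of removal suffices: the edge from the block
vertex of a wrong number into a fixed position. -/
theorem solvable_iff_isHamiltonian {n : ℕ} (hn : 2 ≤ n) (P : Puzzle n) :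
    Solvable P ↔ IsHamiltonian (puzzleGraph P) := by
  have h4 := four_le_sq hn
  constructor
  · rintro ⟨S, hS, hP⟩
    obtain ⟨σ, hσ, hnext⟩ := exists_hamCycle hn (z := ⟨0, by omega⟩) rfl hS
    refine ⟨σ, hσ.1, fun u => ⟨hσ.2 u, ?_⟩⟩
    rw [hnext]
    exact not_redundant_next hS hP u
  · rintro ⟨σ, hσ⟩
    obtain ⟨S, hc, hS⟩ := exists_corresponds hn (fun u => (hσ.2 u).1) (hσ.two_cycle_free hn)
    refine ⟨S, hS, fun i j k hk => ?_⟩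
    by_contra hne
    have h1 := (hσ.2 (b (block i j) (S i j))).2
    rw [hc.b_x] at h1
    exact h1 (.cell_b i j k _ hk hne)

end SudokuHCP

namespace SudokuHCP

/-! ### A programming language with bounded loops, compiled to the random access machine -/

/-- Numerical expressions: variables, literals, sums, truncated differences, products, the input
entry at a computed place, and sums over all values of a variable below the first input entry. -/
inductive NExpr : Type where
  | var (v : ℕ)
  | lit (z : ℕ)
  | add (e e' : NExpr)
  | sub (e e' : NExpr)
  | mul (e e' : NExpr)
  | rd (e : NExpr)
  | sum (v : ℕ) (e : NExpr)

/-- Statements: append a value to the output, composition, conditional execution, and a loop over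
all values of a variable below the first input entry. -/
inductive Stmt : Type where
  | emit (e : NExpr)
  | seq (A B : Stmt)
  | guard (e : NExpr) (A : Stmt)
  | loop (v : ℕ) (A : Stmt)

/-- The value of an expression on input `inp` if the variables have the values `env`. -/
def NExpr.eval (inp : List ℕ) : NExpr → (ℕ → ℕ) → ℕ
  | .var v, env => env v
  | .lit z, _ => z
  | .add e e', env => e.eval inp env + e'.eval inp env
  | .sub e e', env => e.eval inp env - e'.eval inp env
  | .mul e e', env => e.eval inp env * e'.eval inp env
  | .rd e, env => inp.getD (e.eval inp env) 0
  | .sum v e, env => ∑ q ∈ Finset.range (inp.getD 0 0), e.eval inp (Function.update env v q)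

/-- The output of a statement on input `inp` if the variables have the values `env`. -/
def Stmt.output (inp : List ℕ) : Stmt → (ℕ → ℕ) → List ℕ
  | .emit e, env => [e.eval inp env]
  | .seq A B, env => A.output inp env ++ B.output inp env
  | .guard e A, env => if e.eval inp env ≠ 0 then A.output inp env else []
  | .loop v A, env =>
    (List.range (inp.getD 0 0)).flatMap fun q => A.output inp (Function.update env v q)

/-- Several instructions. -/
def line : Instr → List Instr → Prog
  | o, [] => .instr o
  | o, o' :: l => .seq (.instr o) (line o' l)

/-- The program that computes an expression: variable `v` is kept in cell `2 * v`, the result is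
placed in cell `2 * d + 1`, and the odd cells from `2 * d + 1` on serve as working memory. -/
def NExpr.compile : NExpr → ℕ → Prog
  | .var v, d => line (.const (2 * d + 1) 0) [.add (2 * d + 1) (2 * d + 1) (2 * v)]
  | .lit z, d => .instr (.const (2 * d + 1) z)
  | .add e e', d => .seq (e.compile d) (.seq (e'.compile (d + 1))
      (.instr (.add (2 * d + 1) (2 * d + 1) (2 * d + 3))))
  | .sub e e', d => .seq (e.compile d) (.seq (e'.compile (d + 1))
      (.instr (.sub (2 * d + 1) (2 * d + 1) (2 * d + 3))))
  | .mul e e', d => .seq (e.compile d) (.seq (e'.compile (d + 1))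
      (.seq (line (.const (2 * d + 5) 0) [.const (2 * d + 7) 1])
      (.seq (.loop (2 * d + 1) (line (.add (2 * d + 5) (2 * d + 5) (2 * d + 3))
        [.sub (2 * d + 1) (2 * d + 1) (2 * d + 7)]))
      (.instr (.add (2 * d + 1) (2 * d + 1) (2 * d + 5))))))
  | .rd e, d => .seq (e.compile d) (.instr (.read (2 * d + 1) (2 * d + 1)))
  | .sum v e, d =>
      .seq (line (.const (2 * d + 1) 0) [.add (2 * d + 3) (2 * d + 1) (2 * v),
        .read (2 * d + 5) (2 * d + 1), .const (2 * d + 7) 1, .const (2 * v) 0])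
      (.seq (.loop (2 * d + 5) (.seq (e.compile (d + 4))
        (line (.add (2 * d + 1) (2 * d + 1) (2 * d + 9)) [.add (2 * v) (2 * v) (2 * d + 7),
          .sub (2 * d + 5) (2 * d + 5) (2 * d + 7)])))
      (.instr (.add (2 * v) (2 * d + 3) (2 * d + 5))))

/-- The program that executes a statement. -/
def Stmt.compile : Stmt → ℕ → Prog
  | .emit e, d => .seq (e.compile d) (.instr (.write (2 * d + 1)))
  | .seq A B, d => .seq (A.compile d) (B.compile d)
  | .guard e A, d => .seq (e.compile d)
      (.ite (2 * d + 1) (A.compile d) (.instr (.const (2 * d + 1) 0)))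
  | .loop v A, d =>
      .seq (line (.const (2 * d + 1) 0) [.add (2 * d + 3) (2 * d + 1) (2 * v),
        .read (2 * d + 5) (2 * d + 1), .const (2 * d + 7) 1, .const (2 * v) 0])
      (.seq (.loop (2 * d + 5) (.seq (A.compile (d + 4))
        (line (.add (2 * v) (2 * v) (2 * d + 7)) [.sub (2 * d + 5) (2 * d + 5) (2 * d + 7)])))
      (.instr (.add (2 * v) (2 * d + 3) (2 * d + 5))))

open Polynomial in
/-- A bound for the value of an expression in terms of the first input entry. -/
noncomputable def NExpr.bound : NExpr → ℕ[X]
  | .var _ => X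
  | .lit z => C z
  | .add e e' => e.bound + e'.bound
  | .sub e _ => e.bound
  | .mul e e' => e.bound * e'.bound
  | .rd _ => X
  | .sum _ e => X * e.bound

open Polynomial in
/-- A bound for the number of steps for the computation of an expression. -/
noncomputable def NExpr.time : NExpr → ℕ[X]
  | .var _ => 2
  | .lit _ => 1
  | .add e e' => e.time + e'.time + 1
  | .sub e e' => e.time + e'.time + 1
  | .mul e e' => e.time + e'.time + e.bound * 3 + 4
  | .rd e => e.time + 1
  | .sum _ e => X * (e.time + 4) + 7

open Polynomial in
/-- A bound for the number of steps for the execution of a statement. -/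
noncomputable def Stmt.time : Stmt → ℕ[X]
  | .emit e => e.time + 1
  | .seq A B => A.time + B.time
  | .guard e A => e.time + A.time + 2
  | .loop _ A => X * (A.time + 3) + 7

/-! ### Correctness and step counts of compiled programs -/

theorem runs_line (inp : List ℕ) (o : Instr) (l : List Instr) (S : RamState) :
    Runs inp (line o l) S (l.length + 1) ((o :: l).foldl (fun S o => o.exec inp S) S) := by
  induction l generalizing o S with
  | nil => exact .instr o S
  | cons o' l ih =>
    rw [List.length_cons, add_comm]
    exact .seq (.instr o S) (ih o' _)

/-- The rule for loops with a counter cell `p` that drops by one in each pass; the invariant is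
indexed by the number of passes still to come. Each pass costs one further step for its test, and
the failing test costs one more. -/
theorem runs_loop {inp : List ℕ} {p t : ℕ} {A : Prog} {inv : ℕ → RamState → Prop}
    (hA : ∀ m S, S.mem p = m + 1 → inv (m + 1) S →
      ∃ T S', Runs inp A S T S' ∧ T ≤ t ∧ S'.mem p = m ∧ inv m S') (m : ℕ) (S : RamState)
    (hm : S.mem p = m) (hS : inv m S) :
    ∃ T S', Runs inp (.loop p A) S T S' ∧ T ≤ m * (t + 1) + 1 ∧ S'.mem p = 0 ∧ inv 0 S' := by
  induction m generalizing S with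
  | zero => exact ⟨1, S, .loop_done hm, by simp, hm, hS⟩
  | succ m ih =>
    obtain ⟨T, S', hr, hT, hp, hS'⟩ := hA m S hm hS
    obtain ⟨T', S'', hr', hT', hp', hS''⟩ := ih S' hp hS'
    refine ⟨T + 1 + T', S'', .loop_step (by omega) hr hr', ?_, hp', hS''⟩
    rw [add_mul]
    omega

/-- Values have to be bounded because a product takes as many passes as its first factor. The
assumption on the input bounds what `rd` returns. -/
theorem NExpr.eval_le_bound {inp : List ℕ} (hin : ∀ q, inp.getD q 0 ≤ inp.getD 0 0) (e : NExpr)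
    {env : ℕ → ℕ} (henv : ∀ v, env v ≤ inp.getD 0 0) :
    e.eval inp env ≤ e.bound.eval (inp.getD 0 0) := by
  induction e generalizing env with
  | var v => simpa [eval, bound] using henv v
  | lit z => simp [eval, bound]
  | add e e' ih ih' => simpa [eval, bound] using add_le_add (ih henv) (ih' henv)
  | sub e e' ih ih' => exact (Nat.sub_le _ _).trans (ih henv)
  | mul e e' ih ih' => simpa [eval, bound] using Nat.mul_le_mul (ih henv) (ih' henv)
  | rd e ih => simpa [eval, bound] using hin _
  | sum v e ih =>
    simp only [eval, bound, Polynomial.eval_mul, Polynomial.eval_X]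
    refine (Finset.sum_le_card_nsmul _ _ (e.bound.eval (inp.getD 0 0)) fun q hq => ?_).trans
      (by simp)
    refine ih fun w => ?_
    rw [Function.update_apply]
    split_ifs
    · exact (Finset.mem_range.1 hq).le
    · exact henv w

/-- The state `S'` agrees with `S` on the variables, the working memory below level `d`. -/
structure SameBelow (d : ℕ) (S S' : RamState) : Prop where
  var : ∀ v, S'.mem (2 * v) = S.mem (2 * v)
  tmp : ∀ c, c < d → S'.mem (2 * c + 1) = S.mem (2 * c + 1)

/-- The frame condition `SameBelow` carries the induction: a second operand is compiled one level
higher and leaves the result of the first one in place. -/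
theorem NExpr.compile_spec {inp : List ℕ} (hin : ∀ q, inp.getD q 0 ≤ inp.getD 0 0) (e : NExpr)
    (d : ℕ) (S : RamState) (hS : ∀ v, S.mem (2 * v) ≤ inp.getD 0 0) :
    ∃ T S', Runs inp (e.compile d) S T S' ∧ T ≤ e.time.eval (inp.getD 0 0) ∧
      SameBelow d S S' ∧ S'.out = S.out ∧
      S'.mem (2 * d + 1) = e.eval inp fun v => S.mem (2 * v) := by
  induction e generalizing d S with
  | var v =>
    refine ⟨_, _, runs_line inp _ _ S, by simp [time], ⟨fun w => ?_, fun q hq => ?_⟩, rfl, ?_⟩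
    · simp (disch := omega) [Instr.exec, Function.update_of_ne]
    · simp (disch := omega) [Instr.exec, Function.update_of_ne]
    · simp (disch := omega) [Instr.exec, Function.update_of_ne, eval]
  | lit z =>
    refine ⟨_, _, .instr _ S, by simp [time], ⟨fun w => ?_, fun q hq => ?_⟩, rfl, ?_⟩
    · simp (disch := omega) [Instr.exec, Function.update_of_ne]
    · simp (disch := omega) [Instr.exec, Function.update_of_ne]
    · simp [Instr.exec, eval]
  | add e e' ih ih' =>
    obtain ⟨T₁, S₁, h₁, hT₁, hs₁, ho₁, he₁⟩ := ih d S hS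
    obtain ⟨T₂, S₂, h₂, hT₂, hs₂, ho₂, he₂⟩ := ih' (d + 1) S₁ fun v => hs₁.var v ▸ hS v
    simp only [hs₁.var] at he₂
    refine ⟨_, _, .seq h₁ (.seq h₂ (.instr _ S₂)), ?_, ⟨fun w => ?_, fun q hq => ?_⟩,
      ho₂.trans ho₁, ?_⟩
    · simp [time, -List.getD_eq_getElem?_getD]; omega
    · simp (disch := omega) [Instr.exec, Function.update_of_ne, hs₂.var, hs₁.var]
    · simp (disch := omega) [Instr.exec, Function.update_of_ne, hs₂.tmp, hs₁.tmp]
    · simp [Instr.exec, eval, ← he₁, ← he₂, hs₂.tmp d (by omega), mul_add]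
  | sub e e' ih ih' =>
    obtain ⟨T₁, S₁, h₁, hT₁, hs₁, ho₁, he₁⟩ := ih d S hS
    obtain ⟨T₂, S₂, h₂, hT₂, hs₂, ho₂, he₂⟩ := ih' (d + 1) S₁ fun v => hs₁.var v ▸ hS v
    simp only [hs₁.var] at he₂
    refine ⟨_, _, .seq h₁ (.seq h₂ (.instr _ S₂)), ?_, ⟨fun w => ?_, fun q hq => ?_⟩,
      ho₂.trans ho₁, ?_⟩
    · simp [time, -List.getD_eq_getElem?_getD]; omega
    · simp (disch := omega) [Instr.exec, Function.update_of_ne, hs₂.var, hs₁.var]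
    · simp (disch := omega) [Instr.exec, Function.update_of_ne, hs₂.tmp, hs₁.tmp]
    · simp [Instr.exec, eval, ← he₁, ← he₂, hs₂.tmp d (by omega), mul_add]
  | rd e ih =>
    obtain ⟨T₁, S₁, h₁, hT₁, hs₁, ho₁, he₁⟩ := ih d S hS
    refine ⟨_, _, .seq h₁ (.instr _ S₁), ?_, ⟨fun w => ?_, fun q hq => ?_⟩, ho₁, ?_⟩
    · simp [time, -List.getD_eq_getElem?_getD]; omega
    · simp (disch := omega) [Instr.exec, Function.update_of_ne, hs₁.var]
    · simp (disch := omega) [Instr.exec, Function.update_of_ne, hs₁.tmp]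
    · simp [Instr.exec, eval, he₁]
  | mul e e' ih ih' =>
    obtain ⟨T₁, S₁, h₁, hT₁, hs₁, ho₁, he₁⟩ := ih d S hS
    obtain ⟨T₂, S₂, h₂, hT₂, hs₂, ho₂, he₂⟩ := ih' (d + 1) S₁ fun v => hs₁.var v ▸ hS v
    simp only [hs₁.var] at he₂
    have hb := e.eval_le_bound hin hS
    set x := e.eval inp fun v => S.mem (2 * v) with hx
    set y := e'.eval inp fun v => S.mem (2 * v) with hy
    have hd : S₂.mem (2 * d + 1) = x := (hs₂.tmp d (by omega)).trans he₁
    have hd3 : S₂.mem (2 * d + 3) = y := he₂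
    have h₃ := runs_line inp (.const (2 * d + 5) 0) [.const (2 * d + 7) 1] S₂
    set S₃ := List.foldl (fun S o => Instr.exec inp o S) S₂
      [.const (2 * d + 5) 0, .const (2 * d + 7) 1] with hS₃
    obtain ⟨T₄, S₄, h₄, hT₄, hp₄, hi₄⟩ := runs_loop (inp := inp) (p := 2 * d + 1) (t := 2)
      (A := line (.add (2 * d + 5) (2 * d + 5) (2 * d + 3))
        [.sub (2 * d + 1) (2 * d + 1) (2 * d + 7)])
      -- Multiplication by repeated addition: the first factor counts down, and the accumulated sum
      -- plus `y` for each outstanding pass stays equal to `x * y`. The cell `2 * d + 7` holds the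
      -- decrement 1.
      (inv := fun m R => (∀ v, R.mem (2 * v) = S.mem (2 * v)) ∧
        (∀ q, q < d → R.mem (2 * q + 1) = S.mem (2 * q + 1)) ∧ R.out = S.out ∧
        R.mem (2 * d + 5) + m * y = x * y ∧ R.mem (2 * d + 3) = y ∧ R.mem (2 * d + 7) = 1) (by
        rintro m R hR ⟨i₁, i₂, i₃, i₄, i₅, i₆⟩
        refine ⟨_, _, runs_line inp _ _ R, by simp, ?_, fun v => ?_, fun q hq => ?_, i₃, ?_, ?_, ?_⟩
        · simp (disch := omega) [Instr.exec, Function.update_of_ne, hR, i₆]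
        · simp (disch := omega) [Instr.exec, Function.update_of_ne, i₁]
        · simp (disch := omega) [Instr.exec, Function.update_of_ne, i₂]
        · simp (disch := omega) [Instr.exec, Function.update_of_ne, i₅]
          linarith
        · simp (disch := omega) [Instr.exec, Function.update_of_ne, i₅]
        · simp (disch := omega) [Instr.exec, Function.update_of_ne, i₆])
      x S₃
      (by simp (disch := omega) [hS₃, Instr.exec, Function.update_of_ne, hd])
      ⟨fun v => by simp (disch := omega) [hS₃, Instr.exec, Function.update_of_ne, hs₂.var, hs₁.var],
        fun q hq => by
          simp (disch := omega) [hS₃, Instr.exec, Function.update_of_ne, hs₂.tmp, hs₁.tmp],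
        by simp [hS₃, Instr.exec, ho₂, ho₁],
        by simp (disch := omega) [hS₃, Instr.exec, Function.update_of_ne],
        by simp (disch := omega) [hS₃, Instr.exec, Function.update_of_ne, hd3],
        by simp [hS₃, Instr.exec]⟩
    obtain ⟨i₁, i₂, i₃, i₄, i₅, i₆⟩ := hi₄
    refine ⟨_, _, .seq h₁ (.seq h₂ (.seq h₃ (.seq h₄ (.instr _ S₄)))), ?_,
      ⟨fun w => ?_, fun q hq => ?_⟩, i₃, ?_⟩
    · simp [time, -List.getD_eq_getElem?_getD]; omega
    · simp (disch := omega) [Instr.exec, Function.update_of_ne, i₁]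
    · simp (disch := omega) [Instr.exec, Function.update_of_ne, i₂]
    · simp [Instr.exec, eval, hp₄, ← hx, ← hy, ← i₄]
  | sum v e ih =>
    set N := inp.getD 0 0 with hN
    set env := fun w => S.mem (2 * w) with henv
    have h₁ := runs_line inp (.const (2 * d + 1) 0) [.add (2 * d + 3) (2 * d + 1) (2 * v),
        .read (2 * d + 5) (2 * d + 1), .const (2 * d + 7) 1, .const (2 * v) 0] S
    set S₁ := List.foldl (fun S o => Instr.exec inp o S) S
      [.const (2 * d + 1) 0, .add (2 * d + 3) (2 * d + 1) (2 * v),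
        .read (2 * d + 5) (2 * d + 1), .const (2 * d + 7) 1, .const (2 * v) 0] with hS₁
    obtain ⟨T₂, S₂, h₂, hT₂, hp₂, hi₂⟩ := runs_loop (inp := inp) (p := 2 * d + 5)
      (t := e.time.eval N + 3)
      (A := .seq (e.compile (d + 4))
        (line (.add (2 * d + 1) (2 * d + 1) (2 * d + 9)) [.add (2 * v) (2 * v) (2 * d + 7),
          .sub (2 * d + 5) (2 * d + 5) (2 * d + 7)]))
      -- The summation variable counts up while the loop counter counts down, with constant sum `N`.
      -- The old value of the variable is kept in cell `2 * d + 3`; the body works from level `d +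
      -- 4` on and spares these cells.
      (inv := fun m R => (∀ w, w ≠ v → R.mem (2 * w) = S.mem (2 * w)) ∧
        (∀ q, q < d → R.mem (2 * q + 1) = S.mem (2 * q + 1)) ∧ R.out = S.out ∧
        R.mem (2 * v) + m = N ∧
        R.mem (2 * d + 1) = ∑ q ∈ Finset.range (R.mem (2 * v)),
          e.eval inp (Function.update env v q) ∧
        R.mem (2 * d + 3) = S.mem (2 * v) ∧ R.mem (2 * d + 7) = 1) (by
        rintro m R hR ⟨i₁, i₂, i₃, i₄, i₅, i₆, i₇⟩
        have hRenv : (fun w => R.mem (2 * w)) = Function.update env v (R.mem (2 * v)) := by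
          funext w
          rw [Function.update_apply]
          split_ifs with hw
          · rw [hw]
          · exact i₁ w hw
        obtain ⟨T, R', hr, hT, hs, ho, he⟩ := ih (d + 4) R fun w => by
          by_cases hw : w = v
          · rw [hw]; omega
          · rw [i₁ w hw]; exact hS w
        have t₀ := hs.tmp d (by omega)
        have t₁ := hs.tmp (d + 1) (by omega)
        have t₂ := hs.tmp (d + 2) (by omega)
        have t₃ := hs.tmp (d + 3) (by omega)
        simp only [mul_add, add_assoc, Nat.reduceMul, Nat.reduceAdd] at t₁ t₂ t₃ he
        rw [hRenv] at he
        refine ⟨_, _, .seq hr (runs_line inp _ _ R'), by simpa using hT, ?_, fun w hw => ?_,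
          fun q hq => ?_, ho.trans i₃, ?_, ?_, ?_, ?_⟩
        · simp (disch := omega) [Instr.exec, Function.update_of_ne, t₂, hR, t₃, i₇]
        · simp (disch := omega) [Instr.exec, Function.update_of_ne, hs.var, i₁ w hw]
        · simp (disch := omega) [Instr.exec, Function.update_of_ne, i₂ q hq, hs.tmp q]
        · simp (disch := omega) [Instr.exec, Function.update_of_ne, hs.var, t₃, i₇]
          omega
        · simp (disch := omega) [Instr.exec, Function.update_of_ne, hs.var, t₃, i₇, he, t₀, i₅,
            Finset.sum_range_succ]
        · simp (disch := omega) [Instr.exec, Function.update_of_ne, t₁, i₆]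
        · simp (disch := omega) [Instr.exec, Function.update_of_ne, t₃, i₇])
      N S₁
      (by simp (disch := omega) [hS₁, Instr.exec, Function.update_of_ne, hN])
      ⟨fun w hw => by simp (disch := omega) [hS₁, Instr.exec, Function.update_of_ne],
        fun q hq => by simp (disch := omega) [hS₁, Instr.exec, Function.update_of_ne],
        by simp [hS₁, Instr.exec],
        by simp [hS₁, Instr.exec],
        by simp (disch := omega) [hS₁, Instr.exec, Function.update_of_ne],
        by simp (disch := omega) [hS₁, Instr.exec, Function.update_of_ne],
        by simp (disch := omega) [hS₁, Instr.exec, Function.update_of_ne]⟩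
    obtain ⟨i₁, i₂, i₃, i₄, i₅, i₆, i₇⟩ := hi₂
    refine ⟨_, _, .seq h₁ (.seq h₂ (.instr _ S₂)), ?_, ⟨fun w => ?_, fun q hq => ?_⟩, i₃, ?_⟩
    -- The constant 7 consists of five instructions before the loop, the failing test and one
    -- instruction that restores the variable.
    · simp [time, mul_add] at hT₂ ⊢; omega
    · by_cases hw : w = v
      · subst hw
        simp [Instr.exec, hp₂, i₆]
      · simp (disch := omega) [Instr.exec, Function.update_of_ne, i₁ w hw]
    · simp (disch := omega) [Instr.exec, Function.update_of_ne, i₂]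
    · rw [add_zero] at i₄
      simp (disch := omega) [Instr.exec, Function.update_of_ne, i₅, i₄, eval, hN]

/-- The same induction with the output appended. The loop invariant records the output for the
values that the loop variable has already passed. -/
theorem Stmt.compile_spec {inp : List ℕ} (hin : ∀ q, inp.getD q 0 ≤ inp.getD 0 0) (A : Stmt)
    (d : ℕ) (S : RamState) (hS : ∀ v, S.mem (2 * v) ≤ inp.getD 0 0) :
    ∃ T S', Runs inp (A.compile d) S T S' ∧ T ≤ A.time.eval (inp.getD 0 0) ∧
      SameBelow d S S' ∧ S'.out = S.out ++ A.output inp fun v => S.mem (2 * v) := by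
  induction A generalizing d S with
  | emit e =>
    obtain ⟨T, S', h, hT, hs, ho, he⟩ := e.compile_spec hin d S hS
    refine ⟨_, _, .seq h (.instr _ S'), ?_, ⟨hs.var, hs.tmp⟩, ?_⟩
    · simpa [time] using hT
    · simp [Instr.exec, output, ho, he]
  | seq A B ihA ihB =>
    obtain ⟨T₁, S₁, h₁, hT₁, hs₁, ho₁⟩ := ihA d S hS
    obtain ⟨T₂, S₂, h₂, hT₂, hs₂, ho₂⟩ := ihB d S₁ fun v => hs₁.var v ▸ hS v
    simp only [hs₁.var] at ho₂
    refine ⟨_, _, .seq h₁ h₂, ?_, ⟨fun v => (hs₂.var v).trans (hs₁.var v),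
      fun q hq => (hs₂.tmp q hq).trans (hs₁.tmp q hq)⟩, ?_⟩
    · simpa [time] using add_le_add hT₁ hT₂
    · simp [output, ho₂, ho₁]
  | guard e A ih =>
    obtain ⟨T₁, S₁, h₁, hT₁, hs₁, ho₁, he₁⟩ := e.compile_spec hin d S hS
    by_cases h0 : S₁.mem (2 * d + 1) = 0
    · refine ⟨_, _, .seq h₁ (.ite_false h0 (.instr _ S₁)), ?_, ⟨fun v => ?_, fun q hq => ?_⟩, ?_⟩
      · simp [time, -List.getD_eq_getElem?_getD]; omega
      · simp (disch := omega) [Instr.exec, Function.update_of_ne, hs₁.var]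
      · simp (disch := omega) [Instr.exec, Function.update_of_ne, hs₁.tmp]
      · rw [he₁] at h0
        simp [Instr.exec, output, h0, ho₁]
    · obtain ⟨T₂, S₂, h₂, hT₂, hs₂, ho₂⟩ := ih d S₁ fun v => hs₁.var v ▸ hS v
      simp only [hs₁.var] at ho₂
      refine ⟨_, _, .seq h₁ (.ite_true h0 h₂), ?_, ⟨fun v => (hs₂.var v).trans (hs₁.var v),
        fun q hq => (hs₂.tmp q hq).trans (hs₁.tmp q hq)⟩, ?_⟩
      · simp [time, -List.getD_eq_getElem?_getD]; omega
      · rw [he₁] at h0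
        simp [output, h0, ho₂, ho₁]
  | loop v A ih =>
    set N := inp.getD 0 0 with hN
    set env := fun w => S.mem (2 * w) with henv
    have h₁ := runs_line inp (.const (2 * d + 1) 0) [.add (2 * d + 3) (2 * d + 1) (2 * v),
        .read (2 * d + 5) (2 * d + 1), .const (2 * d + 7) 1, .const (2 * v) 0] S
    set S₁ := List.foldl (fun S o => Instr.exec inp o S) S
      [.const (2 * d + 1) 0, .add (2 * d + 3) (2 * d + 1) (2 * v),
        .read (2 * d + 5) (2 * d + 1), .const (2 * d + 7) 1, .const (2 * v) 0] with hS₁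
    obtain ⟨T₂, S₂, h₂, hT₂, hp₂, hi₂⟩ := runs_loop (inp := inp) (p := 2 * d + 5)
      (t := A.time.eval N + 2)
      (A := .seq (A.compile (d + 4))
        (line (.add (2 * v) (2 * v) (2 * d + 7)) [.sub (2 * d + 5) (2 * d + 5) (2 * d + 7)]))
      (inv := fun m R => (∀ w, w ≠ v → R.mem (2 * w) = S.mem (2 * w)) ∧
        (∀ q, q < d → R.mem (2 * q + 1) = S.mem (2 * q + 1)) ∧
        R.mem (2 * v) + m = N ∧
        R.out = S.out ++ (List.range (R.mem (2 * v))).flatMap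
          (fun q => A.output inp (Function.update env v q)) ∧
        R.mem (2 * d + 3) = S.mem (2 * v) ∧ R.mem (2 * d + 7) = 1) (by
        rintro m R hR ⟨i₁, i₂, i₄, i₅, i₆, i₇⟩
        have hRenv : (fun w => R.mem (2 * w)) = Function.update env v (R.mem (2 * v)) := by
          funext w
          rw [Function.update_apply]
          split_ifs with hw
          · rw [hw]
          · exact i₁ w hw
        obtain ⟨T, R', hr, hT, hs, ho⟩ := ih (d + 4) R fun w => by
          by_cases hw : w = v
          · rw [hw]; omega
          · rw [i₁ w hw]; exact hS w
        have t₁ := hs.tmp (d + 1) (by omega)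
        have t₂ := hs.tmp (d + 2) (by omega)
        have t₃ := hs.tmp (d + 3) (by omega)
        simp only [mul_add, add_assoc, Nat.reduceMul, Nat.reduceAdd] at t₁ t₂ t₃
        rw [hRenv] at ho
        refine ⟨_, _, .seq hr (runs_line inp _ _ R'), by simpa using hT, ?_, fun w hw => ?_,
          fun q hq => ?_, ?_, ?_, ?_, ?_⟩
        · simp (disch := omega) [Instr.exec, Function.update_of_ne, t₂, hR, t₃, i₇]
        · simp (disch := omega) [Instr.exec, Function.update_of_ne, hs.var, i₁ w hw]
        · simp (disch := omega) [Instr.exec, Function.update_of_ne, i₂ q hq, hs.tmp q]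
        · simp (disch := omega) [Instr.exec, Function.update_of_ne, hs.var, t₃, i₇]
          omega
        · simp (disch := omega) [Instr.exec, Function.update_of_ne, hs.var, t₃, i₇, ho, i₅,
            List.range_succ]
        · simp (disch := omega) [Instr.exec, Function.update_of_ne, t₁, i₆]
        · simp (disch := omega) [Instr.exec, Function.update_of_ne, t₃, i₇])
      N S₁
      (by simp (disch := omega) [hS₁, Instr.exec, Function.update_of_ne, hN])
      ⟨fun w hw => by simp (disch := omega) [hS₁, Instr.exec, Function.update_of_ne],
        fun q hq => by simp (disch := omega) [hS₁, Instr.exec, Function.update_of_ne],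
        by simp [hS₁, Instr.exec],
        by simp [hS₁, Instr.exec],
        by simp (disch := omega) [hS₁, Instr.exec, Function.update_of_ne],
        by simp (disch := omega) [hS₁, Instr.exec, Function.update_of_ne]⟩
    obtain ⟨i₁, i₂, i₄, i₅, i₆, i₇⟩ := hi₂
    refine ⟨_, _, .seq h₁ (.seq h₂ (.instr _ S₂)), ?_, ⟨fun w => ?_, fun q hq => ?_⟩, ?_⟩
    · simp [time, mul_add] at hT₂ ⊢; omega
    · by_cases hw : w = v
      · subst hw
        simp [Instr.exec, hp₂, i₆]
      · simp (disch := omega) [Instr.exec, Function.update_of_ne, i₁ w hw]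
    · simp (disch := omega) [Instr.exec, Function.update_of_ne, i₂]
    · rw [add_zero] at i₄
      simp [Instr.exec, i₅, i₄, output, hN]

end SudokuHCP

namespace SudokuHCP
open Vert

/-! ### Expressions -/

instance : Add NExpr := ⟨.add⟩
instance : Sub NExpr := ⟨.sub⟩
instance : Mul NExpr := ⟨.mul⟩
instance (z : ℕ) : OfNat NExpr z := ⟨.lit z⟩

namespace NExpr

variable (inp : List ℕ) (e e' : NExpr) (env : ℕ → ℕ)

@[simp] theorem eval_add : (e + e').eval inp env = e.eval inp env + e'.eval inp env := rfl
@[simp] theorem eval_sub : (e - e').eval inp env = e.eval inp env - e'.eval inp env := rfl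
@[simp] theorem eval_mul : (e * e').eval inp env = e.eval inp env * e'.eval inp env := rfl
@[simp] theorem eval_ofNat (z : ℕ) : (no_index (OfNat.ofNat z) : NExpr).eval inp env = z := rfl
@[simp] theorem eval_var (v : ℕ) : (var v).eval inp env = env v := rfl
@[simp] theorem eval_rd : (rd e).eval inp env = inp.getD (e.eval inp env) 0 := rfl
@[simp] theorem eval_sum (v : ℕ) : (sum v e).eval inp env =
    ∑ q ∈ Finset.range (inp.getD 0 0), e.eval inp (Function.update env v q) := rfl

/-- The first input entry. -/
def size : NExpr := rd 0

@[simp] theorem eval_size : size.eval inp env = inp.getD 0 0 := rfl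

/-- The indicator of `e ≤ e'`. -/
def le (e e' : NExpr) : NExpr := 1 - (e - e')

@[simp] theorem eval_le :
    (le e e').eval inp env = if e.eval inp env ≤ e'.eval inp env then 1 else 0 := by
  simp only [le, eval_sub, eval_ofNat]
  split_ifs <;> omega

/-- The indicator of `e = e'`. -/
def eq (e e' : NExpr) : NExpr := 1 - ((e - e') + (e' - e))

@[simp] theorem eval_eq :
    (eq e e').eval inp env = if e.eval inp env = e'.eval inp env then 1 else 0 := by
  simp only [eq, eval_sub, eval_add, eval_ofNat]
  split_ifs <;> omega

/-- The integral part of the square root of the first input entry. -/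
def side : NExpr := sum 5 (le ((var 5 + 1) * (var 5 + 1)) size)

/-- The quotient of a variable by `side`. -/
def quot (v : ℕ) : NExpr := sum 6 (le ((var 6 + 1) * side) (var v))

/-- The number of the block of the position given by two variables. -/
def blk (v w : ℕ) : NExpr := side * quot v + quot w

/-- The input entry of the position given by two variables. -/
def entry (v w : ℕ) : NExpr := rd (var v * size + var w + 1)

/-- Variable `2` shifted cyclically by `c`. -/
def shifted (c : NExpr) : NExpr := var 2 + c - size * le size (var 2 + c)

end NExpr

/-- Replaces square root and division by counting: `n` is the number of `q` with `(q + 1) ^ 2 ≤ n ^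
2`, and a quotient `a / n` is the number of `q` with `(q + 1) * n ≤ a`. -/
theorem sum_range_indicator {m M : ℕ} (h : m ≤ M) :
    ∑ q ∈ Finset.range M, (if q + 1 ≤ m then 1 else 0) = m := by
  rw [Finset.sum_boole]
  have : (Finset.range M).filter (fun q => q + 1 ≤ m) = Finset.range m := by
    ext q
    simp only [Finset.mem_filter, Finset.mem_range]
    omega
  rw [this, Finset.card_range, Nat.cast_id]

theorem getElem?_flatMap_of_length {α β : Type*} {g : α → List β} {N : ℕ}
    (hg : ∀ a, (g a).length = N) (l : List α) (i : ℕ) {j : ℕ} (hj : j < N) :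
    (l.flatMap g)[i * N + j]? = l[i]?.bind fun a => (g a)[j]? := by
  induction l generalizing i with
  | nil => simp
  | cons a l ih =>
    rw [List.flatMap_cons]
    cases i with
    | zero => rw [List.getElem?_append_left (by rw [hg]; omega)]; simp
    | succ i =>
      rw [List.getElem?_append_right (by rw [hg, add_mul]; omega), hg,
        show (i + 1) * N + j - N = i * N + j by rw [add_mul]; omega, ih]
      simp

/-! ### Arithmetic on the encoded instance -/

section Encoding

variable {n : ℕ} (P : Puzzle n)

theorem encodePuzzle_getD_zero : (encodePuzzle P).getD 0 0 = n ^ 2 := rfl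

theorem encodePuzzle_getD (i j : Idx n) :
    (encodePuzzle P).getD (i * n ^ 2 + j + 1) 0 =
      ((P i j).map fun k => k.val + 1).getD 0 := by
  rw [encodePuzzle, List.getD_cons_succ, List.getD_eq_getElem?_getD,
    getElem?_flatMap_of_length (N := n ^ 2) (by simp) _ _ j.isLt]
  simp

/-- Supplies the assumption on the input under which the compiler was proved correct. -/
theorem encodePuzzle_getD_le (q : ℕ) :
    (encodePuzzle P).getD q 0 ≤ (encodePuzzle P).getD 0 0 := by
  rw [encodePuzzle_getD_zero, List.getD_eq_getElem?_getD]
  cases h : (encodePuzzle P)[q]? with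
  | none => simp
  | some m =>
    have hm := List.mem_of_getElem? h
    simp only [encodePuzzle, List.mem_cons, List.mem_flatMap, List.mem_finRange, List.mem_map,
      true_and] at hm
    rcases hm with rfl | ⟨i, j, rfl⟩
    · simp
    · cases P i j with
      | none => simp
      | some k => exact k.isLt

variable {P} {env : ℕ → ℕ}

open NExpr

theorem eval_side : side.eval (encodePuzzle P) env = n := by
  simp only [side, eval_sum, eval_le, eval_mul, eval_add, eval_var, eval_ofNat, eval_size,
    Function.update_self, encodePuzzle_getD_zero]
  conv_rhs => rw [← sum_range_indicator (Nat.le_self_pow two_ne_zero n)]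
  simp only [sq, Nat.mul_self_le_mul_self_iff]

/-- Variable 6 is excluded since the sum inside `quot` would capture it. -/
theorem eval_quot {v : ℕ} (hv : v ≠ 6) (hn : 0 < n) (h : env v < n ^ 2) :
    (quot v).eval (encodePuzzle P) env = env v / n := by
  simp only [quot, eval_sum, eval_le, eval_mul, eval_add, eval_var, eval_ofNat, eval_side,
    Function.update_self, encodePuzzle_getD_zero, Function.update_of_ne hv]
  rw [← sum_range_indicator ((Nat.div_le_self (env v) n).trans h.le)]
  simp only [Nat.le_div_iff_mul_le hn]

theorem eval_blk {v w : ℕ} (hv : v ≠ 6) (hw : w ≠ 6) {i j : Idx n} (hi : env v = i)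
    (hj : env w = j) : (blk v w).eval (encodePuzzle P) env = block i j := by
  have hn : 0 < n := Nat.pos_of_ne_zero (by rintro rfl; exact i.elim0)
  simp [blk, eval_side, eval_quot hv hn (hi ▸ i.isLt), eval_quot hw hn (hj ▸ j.isLt), hi, hj,
    block]

theorem eval_entry {v w : ℕ} {i j : Idx n} (hi : env v = i) (hj : env w = j) :
    (entry v w).eval (encodePuzzle P) env = ((P i j).map fun k => k.val + 1).getD 0 := by
  rw [← encodePuzzle_getD]
  simp only [entry, eval_rd, eval_add, eval_mul, eval_var, eval_ofNat, eval_size, hi, hj,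
    encodePuzzle_getD_zero]

/-- Entries are shifted by one, so the 0 of an empty position matches no number. -/
theorem eval_entry_eq_iff {v w : ℕ} {i j k : Idx n} (hi : env v = i) (hj : env w = j) :
    (entry v w).eval (encodePuzzle P) env = k.val + 1 ↔ P i j = some k := by
  rw [eval_entry hi hj]
  cases P i j <;> simp [Fin.ext_iff]

/-- As `k + c < 2 * n ^ 2`, reduction modulo `n ^ 2` subtracts `n ^ 2` at most once. -/
theorem eval_shifted {c : ℕ} (hc : c ≤ n ^ 2) {k : Idx n} (hk : env 2 = k) :
    (shifted (.lit c)).eval (encodePuzzle P) env = shift k c := by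
  have h1 : (NExpr.lit c).eval (encodePuzzle P) env = c := rfl
  have h2 := k.isLt
  simp only [shifted, eval_sub, eval_add, eval_var, eval_mul, eval_size, eval_le,
    encodePuzzle_getD_zero, hk, h1, shift]
  split_ifs with h
  · rw [mul_one, Nat.mod_eq_sub_mod h, Nat.mod_eq_of_lt (by omega)]
  · rw [mul_zero, Nat.mod_eq_of_lt (by omega), Nat.sub_zero]

/-- Lets a sum of natural numbers act as an existential quantifier in the flags below. -/
theorem sum_range_ne_zero_iff {g : ℕ → ℕ} :
    ∑ q ∈ Finset.range (n ^ 2), g q ≠ 0 ↔ ∃ q : Idx n, g q ≠ 0 := by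
  rw [Ne, Finset.sum_eq_zero_iff]
  simp only [Finset.mem_range, not_forall, exists_prop]
  exact ⟨fun ⟨q, hq, h⟩ => ⟨⟨q, hq⟩, h⟩, fun ⟨q, h⟩ => ⟨q, q.isLt, h⟩⟩

end Encoding

/-! ### Redundant edges -/

section Redundant

variable {n : ℕ} (P : Puzzle n)

/-- A number other than `k` is fixed in position `(i, j)`. -/
def CellClash (i j k : Idx n) : Prop := ∃ m, P i j = some m ∧ k ≠ m

/-- Number `k` is fixed elsewhere in the block of position `(i, j)`. -/
def BlockClash (i j k : Idx n) : Prop :=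
  ∃ i' j', P i' j' = some k ∧ block i j = block i' j' ∧ (i, j) ≠ (i', j')

/-- Number `k` is fixed elsewhere in row `i`. -/
def RowClash (i j k : Idx n) : Prop := ∃ j', P i j' = some k ∧ j ≠ j'

/-- Number `k` is fixed elsewhere in column `j`. -/
def ColClash (i j k : Idx n) : Prop := ∃ i', P i' j = some k ∧ i ≠ i'

variable {P} {i j k : Idx n}

/-- Together with the next six lemmas, this reduces redundancy to clashes with fixed numbers, which
a program finds by bounded search. -/
theorem redundant_b_x :
    Redundant P (b (block i j) k) (x i j (shift k 1) 0) ↔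
      BlockClash P i j k ∨ CellClash P i j k := by
  constructor
  · generalize hu : b (block i j) k = u
    generalize hu' : x i j (shift k 1) 0 = u'
    intro h
    cases h with
    | blk_b i' j' k' i₁ j₁ hk hb hne =>
      simp only [Vert.b.injEq, Vert.x.injEq] at hu hu'
      obtain ⟨rfl, rfl, -⟩ := hu'
      obtain ⟨-, rfl⟩ := hu
      exact .inl ⟨_, _, hk, hb, hne⟩
    | cell_b i' j' k' m hk hm =>
      simp only [Vert.b.injEq, Vert.x.injEq] at hu hu'
      obtain ⟨rfl, rfl, -⟩ := hu'
      obtain ⟨-, rfl⟩ := hu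
      exact .inr ⟨_, hk, hm⟩
    | _ => simp at hu hu'
  · rintro (⟨i', j', hk, hb, hne⟩ | ⟨m, hk, hm⟩)
    · rw [hb]
      exact .blk_b i' j' k i j hk hb hne
    · exact .cell_b i j m k hk hm

/-- The number placed by this edge is the omitted one, `k + 1`; hence the shift in the clashes. -/
theorem redundant_x_y :
    Redundant P (x i j k 2) (y i j (shift k 2) 0) ↔
      BlockClash P i j (shift k 1) ∨ CellClash P i j (shift k 1) := by
  have hq : ∀ q : Idx n, k = shift q (n ^ 2 - 1) → shift k 1 = q := by
    rintro q rfl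
    rw [shift_pred_succ q 0, shift_zero]
  constructor
  · generalize hu : x i j k 2 = u
    generalize hu' : y i j (shift k 2) 0 = u'
    intro h
    cases h with
    | blk_x i' j' k' i₁ j₁ hk hb hne =>
      simp only [Vert.x.injEq] at hu
      obtain ⟨rfl, rfl, hkk, -⟩ := hu
      rw [hq _ hkk]
      exact .inl ⟨_, _, hk, hb, hne⟩
    | cell_x i' j' k' m hk hm =>
      simp only [Vert.x.injEq] at hu
      obtain ⟨rfl, rfl, hkk, -⟩ := hu
      rw [hq _ hkk]
      exact .inr ⟨_, hk, hm⟩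
    | _ => simp at hu hu'
  · have h2 : shift k 2 = shift (shift k 1) 1 := (shift_shift k 1 1).symm
    rw [h2]
    nth_rewrite 3 [← shift_succ_pred k]
    rintro (⟨i', j', hk, hb, hne⟩ | ⟨m, hk, hm⟩)
    · exact .blk_x i' j' _ i j hk hb hne
    · exact .cell_x i j m _ hk hm

/-- Again `k + 1` is the number placed. The tail of the edge alone determines it, so the head need
not be analysed. -/
theorem redundant_y_exit :
    Redundant P (y i j k 2) (blockNext (block i j) (shift k 1)) ↔
      BlockClash P i j (shift k 1) ∨ CellClash P i j (shift k 1) := by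
  have hq : ∀ q : Idx n, k = shift q (n ^ 2 - 1) → shift k 1 = q := by
    rintro q rfl
    rw [shift_pred_succ q 0, shift_zero]
  constructor
  · generalize hu : y i j k 2 = u
    generalize hu' : blockNext (block i j) (shift k 1) = u'
    intro h
    cases h with
    | blk_y i' j' k' i₁ j₁ _ hk hb hne he =>
      simp only [Vert.y.injEq] at hu
      obtain ⟨rfl, rfl, hkk, -⟩ := hu
      rw [hq _ hkk]
      exact .inl ⟨_, _, hk, hb, hne⟩
    | cell_y i' j' k' m _ hk hm he =>
      simp only [Vert.y.injEq] at hu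
      obtain ⟨rfl, rfl, hkk, -⟩ := hu
      rw [hq _ hkk]
      exact .inr ⟨_, hk, hm⟩
    | _ => simp at hu
  · nth_rewrite 3 [← shift_succ_pred k]
    rintro (⟨i', j', hk, hb, hne⟩ | ⟨m, hk, hm⟩)
    · exact .blk_y i' j' _ i j _ hk hb hne (hb ▸ blockExit_iff.2 rfl)
    · exact .cell_y i j m _ _ hk hm (blockExit_iff.2 rfl)

theorem redundant_r_x :
    Redundant P (r i k) (x i j k 2) ↔ RowClash P i j k ∨ CellClash P i j k := by
  constructor
  · intro h
    cases h with
    | cell_r _ _ _ _ hk hm => exact .inr ⟨_, hk, hm⟩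
    | row_r _ _ _ _ hk hm => exact .inl ⟨_, hk, hm⟩
  · rintro (⟨j', hk, hj⟩ | ⟨m, hk, hm⟩)
    · exact .row_r i j' k j hk hj
    · exact .cell_r i j m k hk hm

theorem redundant_c_y :
    Redundant P (c j k) (y i j k 2) ↔ ColClash P i j k ∨ CellClash P i j k := by
  constructor
  · intro h
    cases h with
    | cell_c _ _ _ _ hk hm => exact .inr ⟨_, hk, hm⟩
    | col_c _ _ _ _ hk hm => exact .inl ⟨_, hk, hm⟩
  · rintro (⟨i', hk, hi⟩ | ⟨m, hk, hm⟩)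
    · exact .col_c i' j k i hk hi
    · exact .cell_c i j m k hk hm

theorem redundant_x_v : Redundant P (x i j k 0) (v i j) ↔ RowClash P i j k := by
  constructor
  · intro h
    cases h with
    | row_v _ _ _ _ hk hm => exact ⟨_, hk, hm⟩
  · rintro ⟨j', hk, hj⟩
    exact .row_v i j' k j hk hj

theorem redundant_y_w : Redundant P (y i j k 0) (w i j) ↔ ColClash P i j k := by
  constructor
  · generalize hu : y i j k 0 = u
    intro h
    cases h with
    | col_w _ _ _ _ hk hm =>
      simp only [Vert.y.injEq] at hu
      obtain ⟨-, -, rfl, -⟩ := hu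
      exact ⟨_, hk, hm⟩
    | blk_y _ _ _ _ _ _ _ _ _ he => cases he
    | cell_y _ _ _ _ _ _ _ he => cases he
  · rintro ⟨i', hk, hi⟩
    exact .col_w i' j k i hk hi

/-- The edges that can be redundant lead to specific kinds of vertices. -/
theorem Redundant.cases_head {u u' : Vert n} (h : Redundant P u u') :
    (∃ a k i j q, u = b a k ∧ u' = x i j q 0) ∨ (∃ i j k q, u = x i j k 2 ∧ u' = y i j q 0) ∨
      (∃ i j k a q, u = y i j k 2 ∧ BlockExit a q u') ∨ (∃ i k j, u = r i k ∧ u' = x i j k 2) ∨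
      (∃ i j k, u = c j k ∧ u' = y i j k 2) ∨ (∃ i j k, u = x i j k 0 ∧ u' = v i j) ∨
      ∃ i j k, u = y i j k 0 ∧ u' = w i j := by
  cases h
  case blk_b => simp
  case blk_x => simp
  case blk_y => simpa using ⟨_, _, ‹_›⟩
  case cell_b => simp
  case cell_x => simp
  case cell_y => simpa using ⟨_, _, ‹_›⟩
  all_goals simp

end Redundant

/-! ### Expressions that detect clashes -/

section Flags

open NExpr

variable {n : ℕ} {P : Puzzle n} {env : ℕ → ℕ} {i j k : Idx n}

/-- Nonzero if a number other than `e` is fixed in the position given by variables `0` and `1`. -/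
def cellFlag (e : NExpr) : NExpr := entry 0 1 * (1 - NExpr.eq (entry 0 1) (e + 1))

/-- Nonzero if `e` is fixed elsewhere in the block of the position given by variables `0`, `1`. -/
def blockFlag (e : NExpr) : NExpr :=
  sum 3 (sum 4 (NExpr.eq (entry 3 4) (e + 1) * (NExpr.eq (blk 0 1) (blk 3 4) *
    ((1 - NExpr.eq (var 0) (var 3)) + (1 - NExpr.eq (var 1) (var 4))))))

/-- Nonzero if `e` is fixed elsewhere in the row of the position given by variables `0`, `1`. -/
def rowFlag (e : NExpr) : NExpr :=
  sum 4 (NExpr.eq (entry 0 4) (e + 1) * (1 - NExpr.eq (var 1) (var 4)))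

/-- Nonzero if `e` is fixed elsewhere in the column of the position given by variables `0`, `1`. -/
def colFlag (e : NExpr) : NExpr :=
  sum 3 (NExpr.eq (entry 3 1) (e + 1) * (1 - NExpr.eq (var 0) (var 3)))

theorem eval_cellFlag (h0 : env 0 = i) (h1 : env 1 = j) {e : NExpr}
    (he : e.eval (encodePuzzle P) env = k) :
    (cellFlag e).eval (encodePuzzle P) env ≠ 0 ↔ CellClash P i j k := by
  simp only [cellFlag, eval_mul, eval_sub, eval_eq, eval_add, eval_ofNat, he,
    eval_entry h0 h1, CellClash]
  cases P i j with
  | none => simp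
  | some m =>
    by_cases h : k = m
    · simp [h]
    · have h' : m ≠ k := Ne.symm h
      simp [h, h', Fin.val_inj]

/-- Inside the flag, `e` is evaluated with variables 3 and 4 rebound, so its value must depend on
variable 2 only. -/
theorem eval_blockFlag (h0 : env 0 = i) (h1 : env 1 = j) {e : NExpr}
    (he : ∀ env' : ℕ → ℕ, env' 2 = env 2 → e.eval (encodePuzzle P) env' = k) :
    (blockFlag e).eval (encodePuzzle P) env ≠ 0 ↔ BlockClash P i j k := by
  simp only [blockFlag, eval_sum, encodePuzzle_getD_zero, sum_range_ne_zero_iff, BlockClash]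
  refine exists_congr fun i' => exists_congr fun j' => ?_
  set env' := Function.update (Function.update env 3 i') 4 j' with henv
  have g0 : env' 0 = i := by simp [henv, h0]
  have g1 : env' 1 = j := by simp [henv, h1]
  have g3 : env' 3 = i' := by simp [henv]
  have g4 : env' 4 = j' := by simp [henv]
  simp only [eval_mul, eval_eq, eval_add, eval_sub, eval_ofNat, eval_var,
    he env' (by simp [henv]), eval_entry_eq_iff g3 g4, eval_blk (by decide) (by decide) g0 g1,
    eval_blk (by decide) (by decide) g3 g4, g0, g1, g3, g4, ← Fin.ext_iff, Prod.mk.injEq, Ne]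
  split_ifs <;> simp_all

theorem eval_rowFlag (h0 : env 0 = i) (h1 : env 1 = j) {e : NExpr}
    (he : ∀ env' : ℕ → ℕ, env' 2 = env 2 → e.eval (encodePuzzle P) env' = k) :
    (rowFlag e).eval (encodePuzzle P) env ≠ 0 ↔ RowClash P i j k := by
  simp only [rowFlag, eval_sum, encodePuzzle_getD_zero, sum_range_ne_zero_iff, RowClash]
  refine exists_congr fun j' => ?_
  set env' := Function.update env 4 j' with henv
  have g0 : env' 0 = i := by simp [henv, h0]
  have g1 : env' 1 = j := by simp [henv, h1]
  have g4 : env' 4 = j' := by simp [henv]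
  simp only [eval_mul, eval_eq, eval_add, eval_sub, eval_ofNat, eval_var,
    he env' (by simp [henv]), eval_entry_eq_iff g0 g4, g1, g4, ← Fin.ext_iff, Ne]
  split_ifs <;> simp_all

theorem eval_colFlag (h0 : env 0 = i) (h1 : env 1 = j) {e : NExpr}
    (he : ∀ env' : ℕ → ℕ, env' 2 = env 2 → e.eval (encodePuzzle P) env' = k) :
    (colFlag e).eval (encodePuzzle P) env ≠ 0 ↔ ColClash P i j k := by
  simp only [colFlag, eval_sum, encodePuzzle_getD_zero, sum_range_ne_zero_iff, ColClash]
  refine exists_congr fun i' => ?_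
  set env' := Function.update env 3 i' with henv
  have g0 : env' 0 = i := by simp [henv, h0]
  have g1 : env' 1 = j := by simp [henv, h1]
  have g3 : env' 3 = i' := by simp [henv]
  simp only [eval_mul, eval_eq, eval_add, eval_sub, eval_ofNat, eval_var,
    he env' (by simp [henv]), eval_entry_eq_iff g3 g1, g0, g3, ← Fin.ext_iff, Ne]
  split_ifs <;> simp_all

end Flags

/-! ### The list of edges -/

open Classical in
/-- The heads of the edges of the blank graph with tail `u`. -/
noncomputable def heads {n : ℕ} (z : Idx n) : Vert n → List (Vert n)
  | .s => [b z z]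
  | .f => [s]
  | .b a k => (List.finRange (n ^ 2)).flatMap fun i => (List.finRange (n ^ 2)).flatMap fun j =>
      if block i j = a then [x i j (shift k 1) 0] else []
  | .r i k => (List.finRange (n ^ 2)).flatMap fun j => [x i j k 2]
  | .t i => [succOr i (fun i' => r i' z) (c z z)]
  | .c j k => (List.finRange (n ^ 2)).flatMap fun i => [y i j k 2]
  | .d j => [succOr j (fun j' => c j' z) f]
  | .x i j k l =>
    if l = 0 then [x i j k 1] ++ [v i j] else if l = 1 then [x i j k 0] ++ [x i j k 2]
    else [x i j k 1] ++ ([x i j (shift k 1) 0] ++ [y i j (shift k 2) 0])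
  | .v i _ => (List.finRange (n ^ 2)).flatMap (fun k => [r i k]) ++ [t i]
  | .y i j k l =>
    if l = 0 then [y i j k 1] ++ [w i j] else if l = 1 then [y i j k 0] ++ [y i j k 2]
    else [y i j k 1] ++ ([y i j (shift k 1) 0] ++ [blockNext (block i j) (shift k 1)])
  | .w _ j => (List.finRange (n ^ 2)).flatMap (fun k => [c j k]) ++ [d j]

/-- All vertices. -/
def verts (n : ℕ) : List (Vert n) :=
  let I := List.finRange (n ^ 2)
  [s] ++ ([f] ++ (I.flatMap (fun a => I.flatMap fun k => [b a k]) ++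
  (I.flatMap (fun i => I.flatMap fun k => [r i k]) ++ (I.flatMap (fun i => [t i]) ++
  (I.flatMap (fun j => I.flatMap fun k => [c j k]) ++ (I.flatMap (fun j => [d j]) ++
  (I.flatMap (fun i => I.flatMap fun j => I.flatMap fun k =>
    [x i j k 0] ++ ([x i j k 1] ++ [x i j k 2])) ++
  (I.flatMap (fun i => I.flatMap fun j => [v i j]) ++
  (I.flatMap (fun i => I.flatMap fun j => I.flatMap fun k =>
    [y i j k 0] ++ ([y i j k 1] ++ [y i j k 2])) ++
  I.flatMap (fun i => I.flatMap fun j => [w i j]))))))))))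

theorem edge_iff_mem_heads {n : ℕ} (hn : 2 ≤ n) {z : Idx n} (hz : z.val = 0) {u u' : Vert n} :
    Edge u u' ↔ u' ∈ heads z u := by
  have hz' : ∀ {k : Idx n}, k.val = 0 → k = z := fun h => Fin.ext (h.trans hz.symm)
  cases u with
  | s =>
    simp only [heads, List.mem_singleton]
    constructor
    · intro h
      cases h with
      | s_b a k ha hk => rw [hz' ha, hz' hk]
    · rintro rfl
      exact .s_b _ _ hz hz
  | f =>
    simp only [heads, List.mem_singleton]
    constructor
    · intro h
      cases h
      rfl
    · rintro rfl
      exact .f_s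
  | b a k =>
    rw [edge_b_iff]
    simp [heads, List.mem_flatMap]
  | r i k => simp [edge_r_iff, heads]
  | t i =>
    simp only [heads, List.mem_singleton, succOr]
    constructor
    · intro h
      cases h with
      | t_r _ i' k' hi hk =>
        have h1 := i'.isLt
        rw [dif_pos (by omega), hz' hk]
        congr 1
        exact Fin.ext hi
      | t_c _ j' k' hi hj hk => rw [dif_neg (by omega), hz' hj, hz' hk]
    · rintro rfl
      split_ifs with h
      · exact .t_r _ _ _ rfl hz
      · exact .t_c _ _ _ (by have := i.isLt; omega) hz hz
  | c j k => simp [edge_c_iff, heads]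
  | d j =>
    simp only [heads, List.mem_singleton, succOr]
    constructor
    · intro h
      cases h with
      | d_f hj => rw [dif_neg (by omega)]
      | d_c _ j' k' hj hk =>
        have h1 := j'.isLt
        rw [dif_pos (by omega), hz' hk]
        congr 1
        exact Fin.ext hj
    · rintro rfl
      split_ifs with h
      · exact .d_c _ _ _ rfl hz
      · exact .d_f _ (by have := j.isLt; omega)
  | x i j k l =>
    fin_cases l
    · exact edge_x0_iff.trans (by simp [heads])
    · exact edge_x1_iff.trans (by simp [heads])
    · exact edge_x2_iff.trans (by simp [heads])
  | v i j =>
    simp only [heads, List.mem_append, List.mem_flatMap, List.mem_finRange, List.mem_singleton,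
      true_and]
    constructor
    · intro h
      cases h <;> simp
    · rintro (⟨k, rfl⟩ | rfl)
      exacts [.v_r _ _ _, .v_t _ _]
  | y i j k l =>
    fin_cases l
    · exact edge_y0_iff.trans (by simp [heads])
    · exact edge_y1_iff.trans (by simp [heads])
    · exact (edge_y2_iff hn).trans (by simp [heads, blockExit_iff])
  | w i j =>
    simp only [heads, List.mem_append, List.mem_flatMap, List.mem_finRange, List.mem_singleton,
      true_and]
    constructor
    · intro h
      cases h <;> simp
    · rintro (⟨k, rfl⟩ | rfl)
      exacts [.w_c _ _ _, .w_d _ _]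

theorem nodup_flatMap_finRange {N : ℕ} {α : Type*} {g : Fin N → List α} (h : ∀ q, (g q).Nodup)
    (hd : ∀ q q' u, u ∈ g q → u ∈ g q' → q = q') : ((List.finRange N).flatMap g).Nodup := by
  rw [List.nodup_flatMap]
  refine ⟨fun q _ => h q, (List.nodup_finRange N).imp fun {q q'} hne u hu hu' => ?_⟩
  exact hne (hd q q' u hu hu')

theorem blockNext_ne_y {n : ℕ} {a q i j k : Idx n} {l : Fin 3} :
    blockNext a q ≠ y i j k l := by
  intro h
  have := blockExit_iff.2 h.symm
  cases this

theorem nodup_heads {n : ℕ} {z : Idx n} (u : Vert n) : (heads z u).Nodup := by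
  cases u with
  | x i j k l =>
    fin_cases l <;> simp [heads]
  | y i j k l =>
    fin_cases l <;> simp [heads, blockNext_ne_y.symm]
  | b a k =>
    refine nodup_flatMap_finRange (fun i => nodup_flatMap_finRange (fun j => ?_) ?_) ?_
    · split_ifs <;> simp
    · intro j j' u hu hu'
      split_ifs at hu hu' <;> simp_all
    · intro i i' u hu hu'
      simp only [List.mem_flatMap] at hu hu'
      obtain ⟨j, -, hu⟩ := hu
      obtain ⟨j', -, hu'⟩ := hu'
      split_ifs at hu hu' <;> simp_all
  | r i k => exact nodup_flatMap_finRange (by simp) (by simp_all)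
  | c i k => exact nodup_flatMap_finRange (by simp) (by simp_all)
  | v i j =>
    refine List.nodup_append.2 ⟨nodup_flatMap_finRange (by simp) (by simp_all), by simp, ?_⟩
    simp
  | w i j =>
    refine List.nodup_append.2 ⟨nodup_flatMap_finRange (by simp) (by simp_all), by simp, ?_⟩
    simp
  | _ => simp [heads]

theorem mem_verts {n : ℕ} (u : Vert n) : u ∈ verts n := by
  cases u with
  | x i j k l => fin_cases l <;> simp [verts]
  | y i j k l => fin_cases l <;> simp [verts]
  | _ => simp [verts]

/-- A list that contains every vertex and is exactly as long as there are vertices cannot repeat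
any, so no entries need to be compared. -/
theorem nodup_verts (n : ℕ) : (verts n).Nodup := by
  classical
  have : Fintype (Vert n) := Fintype.ofFinite _
  have h1 : (verts n).length = Nat.card (Vert n) := by
    rw [card_vert]
    simp [verts, List.length_flatMap]
    ring
  have h2 : (verts n).toFinset = Finset.univ := by
    ext u
    simp [mem_verts]
  rw [← Multiset.coe_nodup, ← Multiset.toFinset_card_eq_card_iff_nodup, Multiset.coe_card, h1,
    Nat.card_eq_fintype_card, ← Finset.card_univ, ← h2]
  rfl

/-! ### Programs for parts of the list of edges -/

section Emits

open Classical in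
/-- The edges of the graph of `P` from `u` to vertices in `H`, in the output format. -/
noncomputable def edgeOutput {n : ℕ} (P : Puzzle n) (u : Vert n) (H : List (Vert n)) : List ℕ :=
  (H.filter fun u' => ¬ Redundant P u u').flatMap fun u' => [label u, label u']

/-- The statement `A` outputs the edges of the graph of `P` from `u` to vertices in `H`. -/
def EmitsFrom {n : ℕ} (P : Puzzle n) (env : ℕ → ℕ) (A : Stmt) (u : Vert n)
    (H : List (Vert n)) : Prop :=
  A.output (encodePuzzle P) env = edgeOutput P u H

/-- The statement `A` outputs the edges of the graph of `P` with tails in `U`. -/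
def Emits {n : ℕ} (P : Puzzle n) (z : Idx n) (env : ℕ → ℕ) (A : Stmt) (U : List (Vert n)) :
    Prop :=
  A.output (encodePuzzle P) env = U.flatMap fun u => edgeOutput P u (heads z u)

/-- Output of an edge. -/
def edgeStmt (e e' : NExpr) : Stmt := .seq (.emit e) (.emit e')

variable {n : ℕ} {P : Puzzle n} {z : Idx n} {env : ℕ → ℕ} {A B : Stmt} {u u' : Vert n}
  {H H' U U' : List (Vert n)} {e e' g : NExpr}

/-- This and the following rules follow the shapes of `heads` and `verts`, so a program built in the
same shape is verified piece by piece. -/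
theorem EmitsFrom.edge (he : e.eval (encodePuzzle P) env = label u)
    (he' : e'.eval (encodePuzzle P) env = label u') (hr : ¬ Redundant P u u') :
    EmitsFrom P env (edgeStmt e e') u [u'] := by
  simp [EmitsFrom, edgeStmt, edgeOutput, Stmt.output, he, he', hr]

/-- By truncation, `1 - g` is nonzero exactly if `g` vanishes, whatever the size of the flag. -/
theorem EmitsFrom.guarded_edge (hg : g.eval (encodePuzzle P) env ≠ 0 ↔ Redundant P u u')
    (he : e.eval (encodePuzzle P) env = label u)
    (he' : e'.eval (encodePuzzle P) env = label u') :
    EmitsFrom P env (.guard (1 - g) (edgeStmt e e')) u [u'] := by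
  by_cases hr : Redundant P u u'
  · have h1 := hg.2 hr
    have h2 : 1 - g.eval (encodePuzzle P) env = 0 := by omega
    simp [EmitsFrom, edgeOutput, Stmt.output, hr, h2]
  · have h1 : g.eval (encodePuzzle P) env = 0 := by
      by_contra h
      exact hr (hg.1 h)
    simp [EmitsFrom, edgeStmt, edgeOutput, Stmt.output, he, he', hr, h1]

theorem EmitsFrom.guard {p : Prop} [Decidable p]
    (hg : g.eval (encodePuzzle P) env = if p then 1 else 0)
    (hA : p → EmitsFrom P env A u H) :
    EmitsFrom P env (.guard g A) u (if p then H else []) := by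
  by_cases hp : p
  · simpa [EmitsFrom, Stmt.output, hg, hp] using hA hp
  · simp [EmitsFrom, Stmt.output, hg, hp, edgeOutput]

theorem EmitsFrom.seq (hA : EmitsFrom P env A u H) (hB : EmitsFrom P env B u H') :
    EmitsFrom P env (.seq A B) u (H ++ H') := by
  rw [EmitsFrom] at hA hB
  simp [EmitsFrom, Stmt.output, hA, hB, edgeOutput]

theorem flatMap_range {α : Type*} {N : ℕ} {g : ℕ → List α} :
    (List.range N).flatMap g = (List.finRange N).flatMap fun q : Fin N => g q.val := by
  rw [← List.map_coe_finRange_eq_range, List.flatMap_map]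

theorem EmitsFrom.loop {v : ℕ} {H : Idx n → List (Vert n)}
    (hA : ∀ q : Idx n, EmitsFrom P (Function.update env v q) A u (H q)) :
    EmitsFrom P env (.loop v A) u ((List.finRange (n ^ 2)).flatMap H) := by
  simp only [EmitsFrom, edgeOutput] at hA
  simp only [EmitsFrom, Stmt.output, encodePuzzle_getD_zero, flatMap_range, hA, edgeOutput,
    List.filter_flatMap, List.flatMap_assoc]

theorem EmitsFrom.emits (h : EmitsFrom P env A u (heads z u)) : Emits P z env A [u] := by
  rw [EmitsFrom] at h
  simp [Emits, h]

theorem Emits.seq (hA : Emits P z env A U) (hB : Emits P z env B U') :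
    Emits P z env (.seq A B) (U ++ U') := by
  rw [Emits] at hA hB
  simp [Emits, Stmt.output, hA, hB]

theorem Emits.loop {v : ℕ} {U : Idx n → List (Vert n)}
    (hA : ∀ q : Idx n, Emits P z (Function.update env v q) A (U q)) :
    Emits P z env (.loop v A) ((List.finRange (n ^ 2)).flatMap U) := by
  simp only [Emits] at hA
  simp only [Emits, Stmt.output, encodePuzzle_getD_zero, flatMap_range, hA, List.flatMap_assoc]

/-- Edges are grouped by their tails: no repetition occurs within a group because heads are
distinct, nor between groups because tails are. -/
theorem describesGraph_of_emits (hn : 2 ≤ n) (hz : z.val = 0) (h : Emits P z env A (verts n)) :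
    DescribesGraph (Nat.card (Vert n) :: A.output (encodePuzzle P) env) (puzzleGraph P) := by
  classical
  refine ⟨(verts n).flatMap fun u =>
    ((heads z u).filter fun u' => ¬ Redundant P u u').map (Prod.mk u), ?_, ?_, ?_⟩
  · rw [List.nodup_flatMap]
    refine ⟨fun u _ => ((nodup_heads u).filter _).map (Prod.mk_right_injective u), ?_⟩
    refine (nodup_verts n).imp fun {u u'} hne p hp hp' => ?_
    simp only [List.mem_map] at hp hp'
    obtain ⟨_, -, rfl⟩ := hp
    obtain ⟨_, -, h⟩ := hp'
    exact hne (congrArg Prod.fst h).symm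
  · intro u u'
    simp [mem_verts, puzzleGraph, edge_iff_mem_heads hn hz]
  · rw [Emits] at h
    simp only [h, List.flatMap_assoc, List.flatMap_map, edgeOutput]

end Emits

/-! ### The program -/

section Labels

/-- The label of block vertices as an expression. -/
def labB (a k : NExpr) : NExpr := 3 + a * .size + k
/-- The label of row vertices as an expression. -/
def labR (i k : NExpr) : NExpr := 3 + .size * .size + i * .size + k
/-- The label of end row vertices as an expression. -/
def labT (i : NExpr) : NExpr := 3 + 2 * (.size * .size) + i
/-- The label of column vertices as an expression. -/
def labC (j k : NExpr) : NExpr :=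
  3 + 2 * (.size * .size) + .size + j * .size + k
/-- The label of end column vertices as an expression. -/
def labD (j : NExpr) : NExpr := 3 + 3 * (.size * .size) + .size + j
/-- The label of puzzle vertices as an expression. -/
def labX (k l : NExpr) : NExpr := 3 + 3 * (.size * .size) + 2 * .size +
  3 * ((.var 0 * .size + .var 1) * .size + k) + l
/-- The label of end puzzle vertices as an expression. -/
def labV : NExpr := 3 + 3 * (.size * .size * .size) + 3 * (.size * .size) +
  2 * .size + .var 0 * .size + .var 1
/-- The label of duplicate puzzle vertices as an expression. -/
def labY (k l : NExpr) : NExpr := 3 + 3 * (.size * .size * .size) +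
  4 * (.size * .size) + 2 * .size + 3 * ((.var 0 * .size + .var 1) * .size + k) + l
/-- The label of end duplicate puzzle vertices as an expression. -/
def labW : NExpr := 3 + 6 * (.size * .size * .size) +
  4 * (.size * .size) + 2 * .size + .var 0 * .size + .var 1

/-- The value of `e` or `e'` according to the indicator `g`. -/
def sel (g e e' : NExpr) : NExpr := g * e + (1 - g) * e'

variable {n : ℕ} {P : Puzzle n} {env : ℕ → ℕ} {i j k : Idx n} {e e' : NExpr}

open NExpr

theorem eval_labB (he : e.eval (encodePuzzle P) env = i)
    (he' : e'.eval (encodePuzzle P) env = k) :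
    (labB e e').eval (encodePuzzle P) env = label (b i k) := by
  simp only [labB, eval_add, eval_mul, eval_ofNat, eval_size, encodePuzzle_getD_zero, he, he',
    label]

theorem eval_labR (he : e.eval (encodePuzzle P) env = i)
    (he' : e'.eval (encodePuzzle P) env = k) :
    (labR e e').eval (encodePuzzle P) env = label (r i k) := by
  simp only [labR, eval_add, eval_mul, eval_ofNat, eval_size, encodePuzzle_getD_zero, he, he',
    label]
  ring

theorem eval_labT (he : e.eval (encodePuzzle P) env = i) :
    (labT e).eval (encodePuzzle P) env = label (t i) := by
  simp only [labT, eval_add, eval_mul, eval_ofNat, eval_size, encodePuzzle_getD_zero, he, label]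
  ring

theorem eval_labC (he : e.eval (encodePuzzle P) env = j)
    (he' : e'.eval (encodePuzzle P) env = k) :
    (labC e e').eval (encodePuzzle P) env = label (c j k) := by
  simp only [labC, eval_add, eval_mul, eval_ofNat, eval_size, encodePuzzle_getD_zero, he, he',
    label]
  ring

theorem eval_labD (he : e.eval (encodePuzzle P) env = j) :
    (labD e).eval (encodePuzzle P) env = label (d j) := by
  simp only [labD, eval_add, eval_mul, eval_ofNat, eval_size, encodePuzzle_getD_zero, he, label]
  ring

theorem eval_labX (h0 : env 0 = i) (h1 : env 1 = j) {l : Fin 3}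
    (he : e.eval (encodePuzzle P) env = k) (he' : e'.eval (encodePuzzle P) env = l) :
    (labX e e').eval (encodePuzzle P) env = label (x i j k l) := by
  simp only [labX, eval_add, eval_mul, eval_ofNat, eval_size, eval_var, encodePuzzle_getD_zero,
    h0, h1, he, he', label]
  ring

theorem eval_labV (h0 : env 0 = i) (h1 : env 1 = j) :
    labV.eval (encodePuzzle P) env = label (v i j) := by
  simp only [labV, eval_add, eval_mul, eval_ofNat, eval_size, eval_var, encodePuzzle_getD_zero,
    h0, h1, label]
  ring

theorem eval_labY (h0 : env 0 = i) (h1 : env 1 = j) {l : Fin 3}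
    (he : e.eval (encodePuzzle P) env = k) (he' : e'.eval (encodePuzzle P) env = l) :
    (labY e e').eval (encodePuzzle P) env = label (y i j k l) := by
  simp only [labY, eval_add, eval_mul, eval_ofNat, eval_size, eval_var, encodePuzzle_getD_zero,
    h0, h1, he, he', label]
  ring

theorem eval_labW (h0 : env 0 = i) (h1 : env 1 = j) :
    labW.eval (encodePuzzle P) env = label (w i j) := by
  simp only [labW, eval_add, eval_mul, eval_ofNat, eval_size, eval_var, encodePuzzle_getD_zero,
    h0, h1, label]
  ring

/-- Block vertices are labelled in the order in which a cycle visits them, and the first row vertex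
comes right after the last of them. The program therefore gets the label of the exit by adding 1,
without distinguishing cases. -/
theorem label_blockNext (a k : Idx n) : label (blockNext a k) = label (b a k) + 1 := by
  have ha := a.isLt
  have hk := k.isLt
  unfold blockNext succOr
  split_ifs with h1 h2
  · simp only [label]
    ring
  · have h3 : k.val + 1 = n ^ 2 := by omega
    simp only [label, first]
    linarith
  · have h3 : k.val + 1 = n ^ 2 := by omega
    have h4 : a.val + 1 = n ^ 2 := by omega
    simp only [label, first]
    nlinarith

/-- The label of the vertex that follows the vertex of variable `v`. -/
def labSucc (v : ℕ) (g : NExpr → NExpr) (e : NExpr) : NExpr :=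
  sel (le (var v + 2) size) (g (var v + 1)) e

theorem eval_labSucc {v : ℕ} (hv : env v = i) {g : NExpr → NExpr} {g' : Idx n → Vert n}
    {u : Vert n}
    (hg : ∀ q : Idx n, (var v + 1).eval (encodePuzzle P) env = q →
      (g (var v + 1)).eval (encodePuzzle P) env = label (g' q))
    (he : e.eval (encodePuzzle P) env = label u) :
    (labSucc v g e).eval (encodePuzzle P) env = label (succOr i g' u) := by
  simp only [labSucc, sel, eval_add, eval_mul, eval_sub, eval_le, eval_var, eval_ofNat, eval_size,
    encodePuzzle_getD_zero, hv, he, succOr]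
  by_cases h : i.val + 1 < n ^ 2
  · rw [dif_pos h, if_pos (by omega), hg ⟨i.val + 1, h⟩ (by simp [hv])]
    simp
  · rw [dif_neg h, if_neg (by omega)]
    simp

end Labels

section Program

open NExpr

/-- Nonzero if placing number `e` in the position given by variables `0`, `1` is in conflict with
the numbers fixed in the block and in the position. -/
def placeFlag (e : NExpr) : NExpr := blockFlag e + cellFlag e

/-- The program for the edges from the block vertices. -/
def blockStmt : Stmt :=
  .loop 7 <| .loop 2 <| .loop 0 <| .loop 1 <| .guard (NExpr.eq (blk 0 1) (var 7)) <|
    .guard (1 - placeFlag (var 2)) <|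
      edgeStmt (labB (var 7) (var 2)) (labX (shifted (.lit 1)) 0)

/-- The program for the edges from the row vertices. -/
def rowStmt : Stmt :=
  .loop 0 <| .loop 2 <| .loop 1 <| .guard (1 - (rowFlag (var 2) + cellFlag (var 2))) <|
    edgeStmt (labR (var 0) (var 2)) (labX (var 2) 2)

/-- The program for the edges from the end row vertices. -/
def rowEndStmt : Stmt :=
  .loop 0 <| edgeStmt (labT (var 0)) (labSucc 0 (fun e => labR e 0) (labC 0 0))

/-- The program for the edges from the column vertices. -/
def colStmt : Stmt :=
  .loop 1 <| .loop 2 <| .loop 0 <| .guard (1 - (colFlag (var 2) + cellFlag (var 2))) <|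
    edgeStmt (labC (var 1) (var 2)) (labY (var 2) 2)

/-- The program for the edges from the end column vertices. -/
def colEndStmt : Stmt :=
  .loop 1 <| edgeStmt (labD (var 1)) (labSucc 1 (fun e => labC e 0) 2)

/-- The program for the edges from the puzzle vertices. -/
def xStmt : Stmt :=
  .loop 0 <| .loop 1 <| .loop 2 <|
    .seq (.seq (edgeStmt (labX (var 2) 0) (labX (var 2) 1))
      (.guard (1 - rowFlag (var 2)) (edgeStmt (labX (var 2) 0) labV)))
    (.seq (.seq (edgeStmt (labX (var 2) 1) (labX (var 2) 0))
      (edgeStmt (labX (var 2) 1) (labX (var 2) 2)))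
    (.seq (edgeStmt (labX (var 2) 2) (labX (var 2) 1))
      (.seq (edgeStmt (labX (var 2) 2) (labX (shifted (.lit 1)) 0))
      (.guard (1 - placeFlag (shifted (.lit 1)))
        (edgeStmt (labX (var 2) 2) (labY (shifted (.lit 2)) 0))))))

/-- The program for the edges from the end puzzle vertices. -/
def vStmt : Stmt :=
  .loop 0 <| .loop 1 <|
    .seq (.loop 2 (edgeStmt labV (labR (var 0) (var 2)))) (edgeStmt labV (labT (var 0)))

/-- The program for the edges from the duplicate puzzle vertices. -/
def yStmt : Stmt :=
  .loop 0 <| .loop 1 <| .loop 2 <|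
    .seq (.seq (edgeStmt (labY (var 2) 0) (labY (var 2) 1))
      (.guard (1 - colFlag (var 2)) (edgeStmt (labY (var 2) 0) labW)))
    (.seq (.seq (edgeStmt (labY (var 2) 1) (labY (var 2) 0))
      (edgeStmt (labY (var 2) 1) (labY (var 2) 2)))
    (.seq (edgeStmt (labY (var 2) 2) (labY (var 2) 1))
      (.seq (edgeStmt (labY (var 2) 2) (labY (shifted (.lit 1)) 0))
      (.guard (1 - placeFlag (shifted (.lit 1)))
        (edgeStmt (labY (var 2) 2) (labB (blk 0 1) (shifted (.lit 1)) + 1))))))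

/-- The program for the edges from the end duplicate puzzle vertices. -/
def wStmt : Stmt :=
  .loop 0 <| .loop 1 <|
    .seq (.loop 2 (edgeStmt labW (labC (var 1) (var 2)))) (edgeStmt labW (labD (var 1)))

/-- The program for all edges. -/
def edgesStmt : Stmt :=
  .seq (edgeStmt 1 (labB 0 0)) <| .seq (edgeStmt 2 1) <| .seq blockStmt <| .seq rowStmt <|
    .seq rowEndStmt <| .seq colStmt <| .seq colEndStmt <| .seq xStmt <| .seq vStmt <|
    .seq yStmt wStmt

/-- The program for the graph of an instance. -/
def graphStmt : Stmt :=
  .seq (.emit (6 * (size * size * size) + 5 * (size * size) + 2 * size + 2)) edgesStmt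

variable {n : ℕ} {P : Puzzle n} {z : Idx n} {env : ℕ → ℕ} {i j k : Idx n}

theorem not_blockExit_y {a q : Idx n} {l : Fin 3} : ¬ BlockExit a q (y i j k l) :=
  fun h => nomatch h

theorem eval_shifted_one (hn : 2 ≤ n) (h2 : env 2 = k) {env' : ℕ → ℕ} (h : env' 2 = env 2) :
    (shifted (.lit 1)).eval (encodePuzzle P) env' = shift k 1 :=
  eval_shifted (by have := four_le_sq hn; omega) (h.trans h2)

theorem eval_placeFlag (h0 : env 0 = i) (h1 : env 1 = j) {e : NExpr}
    (he : ∀ env' : ℕ → ℕ, env' 2 = env 2 → e.eval (encodePuzzle P) env' = k) :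
    (placeFlag e).eval (encodePuzzle P) env ≠ 0 ↔ BlockClash P i j k ∨ CellClash P i j k := by
  rw [← eval_blockFlag h0 h1 he, ← eval_cellFlag h0 h1 (he env rfl)]
  simp only [placeFlag, eval_add]
  omega

/-- The block is held in variable 7 because 3 to 6 are bound inside the flags and the block number.
-/
theorem emits_blockStmt (hn : 2 ≤ n) : Emits P z env blockStmt
    ((List.finRange (n ^ 2)).flatMap fun a =>
      (List.finRange (n ^ 2)).flatMap fun k => [b a k]) := by
  refine .loop fun a => .loop fun k => EmitsFrom.emits ?_
  refine .loop fun i => .loop fun j => ?_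
  set env' := Function.update (Function.update (Function.update (Function.update env 7 a) 2 k) 0 i)
    1 j with henv
  have h0 : env' 0 = i := by simp [henv]
  have h1 : env' 1 = j := by simp [henv]
  have h2 : env' 2 = k := by simp [henv]
  have h7 : env' 7 = a := by simp [henv]
  refine .guard ?_ ?_
  · simp [eval_blk (by decide) (by decide) h0 h1, h7, Fin.val_inj]
  · rintro rfl
    exact .guarded_edge
      ((eval_placeFlag (e := var 2) h0 h1 fun env'' h => h.trans h2).trans redundant_b_x.symm)
      (eval_labB h7 h2) (eval_labX h0 h1 (eval_shifted_one hn h2 rfl) rfl)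

theorem emits_rowStmt : Emits P z env rowStmt
    ((List.finRange (n ^ 2)).flatMap fun i =>
      (List.finRange (n ^ 2)).flatMap fun k => [r i k]) := by
  refine .loop fun i => .loop fun k => EmitsFrom.emits ?_
  refine .loop fun j => ?_
  set env' := Function.update (Function.update (Function.update env 0 i) 2 k) 1 j with henv
  have h0 : env' 0 = i := by simp [henv]
  have h1 : env' 1 = j := by simp [henv]
  have h2 : env' 2 = k := by simp [henv]
  refine .guarded_edge ?_ (eval_labR h0 h2) (eval_labX h0 h1 h2 rfl)
  rw [redundant_r_x, ← eval_rowFlag (e := var 2) h0 h1 fun env'' h => h.trans h2,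
    ← eval_cellFlag (e := var 2) h0 h1 h2, eval_add]
  omega

theorem emits_colStmt : Emits P z env colStmt
    ((List.finRange (n ^ 2)).flatMap fun j =>
      (List.finRange (n ^ 2)).flatMap fun k => [c j k]) := by
  refine .loop fun j => .loop fun k => EmitsFrom.emits ?_
  refine .loop fun i => ?_
  set env' := Function.update (Function.update (Function.update env 1 j) 2 k) 0 i with henv
  have h0 : env' 0 = i := by simp [henv]
  have h1 : env' 1 = j := by simp [henv]
  have h2 : env' 2 = k := by simp [henv]
  refine .guarded_edge ?_ (eval_labC h1 h2) (eval_labY h0 h1 h2 rfl)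
  rw [redundant_c_y, ← eval_colFlag (e := var 2) h0 h1 fun env'' h => h.trans h2,
    ← eval_cellFlag (e := var 2) h0 h1 h2, eval_add]
  omega

theorem emits_rowEndStmt (hz : z.val = 0) :
    Emits P z env rowEndStmt ((List.finRange (n ^ 2)).flatMap fun i => [t i]) := by
  refine .loop fun i => EmitsFrom.emits ?_
  have h0 : Function.update env 0 i.val 0 = i := by simp
  refine .edge (eval_labT h0) (eval_labSucc h0 (g := fun e => labR e 0)
    (fun q hq => eval_labR hq hz.symm)
    (eval_labC hz.symm hz.symm)) (mt Redundant.cases_head ?_)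
  simp

theorem emits_colEndStmt (hz : z.val = 0) :
    Emits P z env colEndStmt ((List.finRange (n ^ 2)).flatMap fun j => [d j]) := by
  refine .loop fun j => EmitsFrom.emits ?_
  have h1 : Function.update env 1 j.val 1 = j := by simp
  refine .edge (eval_labD h1) (eval_labSucc h1 (g := fun e => labC e 0)
    (fun q hq => eval_labC hq hz.symm)
    rfl) (mt Redundant.cases_head ?_)
  simp

theorem emits_vStmt : Emits P z env vStmt
    ((List.finRange (n ^ 2)).flatMap fun i =>
      (List.finRange (n ^ 2)).flatMap fun j => [v i j]) := by
  refine .loop fun i => .loop fun j => EmitsFrom.emits ?_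
  have h0 : Function.update (Function.update env 0 i.val) 1 j.val 0 = i := by simp
  have h1 : Function.update (Function.update env 0 i.val) 1 j.val 1 = j := by simp
  refine .seq (.loop fun k => ?_)
    (.edge (eval_labV h0 h1) (eval_labT h0) (mt Redundant.cases_head (by simp)))
  refine .edge (eval_labV ?_ ?_) (eval_labR (k := k) ?_ ?_) (mt Redundant.cases_head (by simp)) <;>
    simp

theorem emits_wStmt : Emits P z env wStmt
    ((List.finRange (n ^ 2)).flatMap fun i =>
      (List.finRange (n ^ 2)).flatMap fun j => [w i j]) := by
  refine .loop fun i => .loop fun j => EmitsFrom.emits ?_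
  have h0 : Function.update (Function.update env 0 i.val) 1 j.val 0 = i := by simp
  have h1 : Function.update (Function.update env 0 i.val) 1 j.val 1 = j := by simp
  refine .seq (.loop fun k => ?_)
    (.edge (eval_labW h0 h1) (eval_labD h1) (mt Redundant.cases_head (by simp)))
  refine .edge (eval_labW ?_ ?_) (eval_labC (k := k) ?_ ?_) (mt Redundant.cases_head (by simp)) <;>
    simp

theorem emits_xStmt (hn : 2 ≤ n) : Emits P z env xStmt
    ((List.finRange (n ^ 2)).flatMap fun i => (List.finRange (n ^ 2)).flatMap fun j =>
      (List.finRange (n ^ 2)).flatMap fun k => [x i j k 0] ++ ([x i j k 1] ++ [x i j k 2])) := by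
  have h4 := four_le_sq hn
  refine .loop fun i => .loop fun j => .loop fun k => ?_
  set env' := Function.update (Function.update (Function.update env 0 i) 1 j) 2 k with henv
  have h0 : env' 0 = i := by simp [henv]
  have h1 : env' 1 = j := by simp [henv]
  have h2 : env' 2 = k := by simp [henv]
  have hX : ∀ {e : NExpr} {l : Fin 3}, e.eval (encodePuzzle P) env' = l →
      (labX (var 2) e).eval (encodePuzzle P) env' = label (x i j k l) :=
    fun h => eval_labX h0 h1 h2 h
  refine .seq (EmitsFrom.emits ?_) (.seq (EmitsFrom.emits ?_) (EmitsFrom.emits ?_))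
  · refine .seq (.edge (hX rfl) (hX rfl) (mt Redundant.cases_head (by simp)))
      (.guarded_edge ?_ (hX rfl) (eval_labV h0 h1))
    exact (eval_rowFlag (e := var 2) h0 h1 fun env'' h => h.trans h2).trans redundant_x_v.symm
  · exact .seq (.edge (hX rfl) (hX rfl) (mt Redundant.cases_head (by simp)))
      (.edge (hX rfl) (hX rfl) (mt Redundant.cases_head (by simp)))
  · refine .seq (.edge (hX rfl) (hX rfl) (mt Redundant.cases_head (by simp)))
      (.seq (.edge (hX rfl) (eval_labX h0 h1 (eval_shifted_one hn h2 rfl) rfl)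
        (mt Redundant.cases_head (by simp)))
      (.guarded_edge ?_ (hX rfl) (eval_labY h0 h1 (eval_shifted (by omega) h2) rfl)))
    exact (eval_placeFlag h0 h1 fun env'' h => eval_shifted_one hn h2 h).trans redundant_x_y.symm

theorem emits_yStmt (hn : 2 ≤ n) : Emits P z env yStmt
    ((List.finRange (n ^ 2)).flatMap fun i => (List.finRange (n ^ 2)).flatMap fun j =>
      (List.finRange (n ^ 2)).flatMap fun k => [y i j k 0] ++ ([y i j k 1] ++ [y i j k 2])) := by
  have h4 := four_le_sq hn
  refine .loop fun i => .loop fun j => .loop fun k => ?_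
  set env' := Function.update (Function.update (Function.update env 0 i) 1 j) 2 k with henv
  have h0 : env' 0 = i := by simp [henv]
  have h1 : env' 1 = j := by simp [henv]
  have h2 : env' 2 = k := by simp [henv]
  have hY : ∀ {e : NExpr} {l : Fin 3}, e.eval (encodePuzzle P) env' = l →
      (labY (var 2) e).eval (encodePuzzle P) env' = label (y i j k l) :=
    fun h => eval_labY h0 h1 h2 h
  refine .seq (EmitsFrom.emits ?_) (.seq (EmitsFrom.emits ?_) (EmitsFrom.emits ?_))
  · refine .seq (.edge (hY rfl) (hY rfl) (mt Redundant.cases_head (by simp)))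
      (.guarded_edge ?_ (hY rfl) (eval_labW h0 h1))
    exact (eval_colFlag (e := var 2) h0 h1 fun env'' h => h.trans h2).trans redundant_y_w.symm
  · exact .seq (.edge (hY rfl) (hY rfl) (mt Redundant.cases_head (by simp)))
      (.edge (hY rfl) (hY rfl) (mt Redundant.cases_head (by simp)))
  · refine .seq (.edge (hY rfl) (hY rfl) (mt Redundant.cases_head (by simp [not_blockExit_y])))
      (.seq (.edge (hY rfl) (eval_labY h0 h1 (eval_shifted_one hn h2 rfl) rfl)
        (mt Redundant.cases_head (by simp [not_blockExit_y])))
      (.guarded_edge ?_ (hY rfl) ?_))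
    · exact (eval_placeFlag h0 h1 fun env'' h => eval_shifted_one hn h2 h).trans
        redundant_y_exit.symm
    · rw [label_blockNext, eval_add, eval_labB (eval_blk (by decide) (by decide) h0 h1)
        (eval_shifted_one hn h2 rfl)]
      rfl

theorem emits_edgesStmt (hn : 2 ≤ n) (hz : z.val = 0) : Emits P z env edgesStmt (verts n) := by
  refine .seq (EmitsFrom.emits ?_) <| .seq (EmitsFrom.emits ?_) <| (emits_blockStmt hn).seq <|
    emits_rowStmt.seq <| (emits_rowEndStmt hz).seq <| emits_colStmt.seq <|
    (emits_colEndStmt hz).seq <| (emits_xStmt hn).seq <| emits_vStmt.seq <|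
    (emits_yStmt hn).seq emits_wStmt
  · exact .edge rfl (eval_labB hz.symm hz.symm) (mt Redundant.cases_head (by simp))
  · exact .edge rfl rfl (mt Redundant.cases_head (by simp))

theorem describesGraph_graphStmt (hn : 2 ≤ n) (P : Puzzle n) (env : ℕ → ℕ) :
    DescribesGraph (graphStmt.output (encodePuzzle P) env) (puzzleGraph P) := by
  have h4 := four_le_sq hn
  have h := describesGraph_of_emits hn rfl
    (emits_edgesStmt (P := P) (z := ⟨0, by omega⟩) (env := env) hn rfl)
  rw [card_vert] at h
  convert h using 1
  simp only [graphStmt, Stmt.output, List.singleton_append, eval_add, eval_mul, eval_ofNat,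
    eval_size, encodePuzzle_getD_zero]
  congr 1
  ring

theorem exists_graph_program : ∃ (A : Prog) (p : Polynomial ℕ), ∀ n : ℕ, 2 ≤ n →
    ∀ P : Puzzle n, ∃ (T : ℕ) (M : RamState), Runs (encodePuzzle P) A RamState.init T M ∧
      T ≤ p.eval (n ^ 2) ∧ DescribesGraph M.out (puzzleGraph P) := by
  -- Neither the program nor the polynomial depends on `n`: the size is read from the first input
  -- entry, at which the polynomial is evaluated.
  refine ⟨graphStmt.compile 0, graphStmt.time, fun n hn P => ?_⟩
  obtain ⟨T, M, hr, hT, -, ho⟩ := graphStmt.compile_spec (encodePuzzle_getD_le P) 0 RamState.init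
    fun v => Nat.zero_le _
  refine ⟨T, M, hr, hT, ?_⟩
  rw [ho]
  exact describesGraph_graphStmt hn P _

end Program

end SudokuHCP

/-! ### The main theorem -/

open SudokuHCP
theorem mainTheorem1 :
    (∀ n : ℕ, 2 ≤ n →
      Nat.card (Vert n) = 6 * (n ^ 2) ^ 3 + 5 * (n ^ 2) ^ 2 + 2 * n ^ 2 + 2 ∧
      (∀ σ : Equiv.Perm (Vert n), IsHamCycle (blankGraph n) σ →
        (∃! S : Grid n, Corresponds σ S) ∧ ∀ S : Grid n, Corresponds σ S → IsSudoku S) ∧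
      (∀ S : Grid n, IsSudoku S →
        ∃ σ : Equiv.Perm (Vert n), IsHamCycle (blankGraph n) σ ∧ Corresponds σ S) ∧
      (∀ P : Puzzle n, Solvable P ↔ IsHamiltonian (puzzleGraph P))) ∧
    (∃ (A : Prog) (p : Polynomial ℕ), ∀ n : ℕ, 2 ≤ n → ∀ P : Puzzle n,
      ∃ (T : ℕ) (M : RamState), Runs (encodePuzzle P) A RamState.init T M ∧
        T ≤ p.eval (n ^ 2) ∧ DescribesGraph M.out (puzzleGraph P)) := by
  refine ⟨fun n hn => ⟨card_vert n, fun σ hσ => ?_, fun S hS => ?_, solvable_iff_isHamiltonian hn⟩,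
    exists_graph_program⟩
  · obtain ⟨S, hc, hS⟩ := exists_corresponds hn hσ.2 (hσ.two_cycle_free hn)
    exact ⟨⟨S, hc, fun T hT => hT.unique hc⟩, fun T hT => hT.unique hc ▸ hS⟩
  · have h4 := four_le_sq hn
    obtain ⟨σ, hσ, hnext⟩ := exists_hamCycle hn (z := ⟨0, by omega⟩) rfl hS
    exact ⟨σ, hσ, corresponds_of_next hn hS hnext⟩
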